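/- Let $\mathcal V$ be a symmetric monoidal closed category whose underlying ordinary category is locally presentable. A $\mathcal V$-functor $P:\mathcal C\to\mathcal V$ is called \emph{small} if it is the left Kan extension of its restriction to some small full subcategory of $\mathcal C$; that is, for some small set $S$ of objects of $\mathcal C$, the actions $P(s)\otimes\mathcal C(s,c)\to P(c)$ exhibit $P(c)$ as the coend $\int^{s\in S}P(s)\otimes\mathcal C(s,c)$ for every $c\in\mathcal C$. For a (possibly large) $\mathcal V$-category $\mathcal K$, let $\mathcal{PK}$ be the $\mathcal V$-category of small presheaves $\mathcal K^{\mathrm{op}}\to\mathcal V$, with homs $\mathcal{PK}(P,Q)=\int_{k}[P(k),Q(k)]$. For a $\mathcal V$-functor $F:\mathcal K\to\mathcal L$, let $\mathcal PF:\mathcal{PK}\to\mathcal{PL}$ be the $\mathcal V$-functor sending a small presheaf to its left Kan extension along $F^{\mathrm{op}}:\mathcal K^{\mathrm{op}}\to\mathcal L^{\mathrm{op}}$. Let $\mathcal K$ and $\mathcal L$ be arbitrary (possibly large) $\mathcal V$-categories and let $F:\mathcal K\to\mathcal L$ be an arbitrary $\mathcal V$-functor. Then the $\mathcal V$-functor $\mathcal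 PF:\mathcal{PK}\to\mathcal{PL}$ has a right adjoint (as a $\mathcal V$-functor) if and only if, for every object $L$ of $\mathcal L$, the presheaf $\mathcal L(F-,L):\mathcal K^{\mathrm{op}}\to\mathcal V$ is small. In that case the right adjoint is given by restriction along $F$: for every small presheaf $G:\mathcal L^{\mathrm{op}}\to\mathcal V$ the restriction $GF^{\mathrm{op}}:\mathcal K^{\mathrm{op}}\to\mathcal V$ is small, the resulting $\mathcal V$-functor $F^*:\mathcal{PL}\to\mathcal{PK}$, $G\mapsto GF^{\mathrm{op}}$, is right adjoint to $\mathcal PF$, and every right adjoint of $\mathcal PF$ is $\mathcal V$-naturally isomorphic to $F^*$. -/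

import Mathlib

open CategoryTheory Limits MonoidalCategory MonoidalClosed Opposite

universe w u u₁ u₂ u₃

noncomputable section

namespace EnrichedPresheaf

section General

variable {V : Type u} [Category.{w} V] [MonoidalCategory V]

section FullSub

variable {C : Type u₁} [EnrichedCategory V C]

/-- The full sub-`V`-category on a set of objects. -/
instance fullSub (S : Set C) : EnrichedCategory V S where
  Hom x y := x.1 ⟶[V] y.1
  id x := eId V x.1
  comp x y z := eComp V x.1 y.1 z.1
  id_comp x y := e_id_comp V x.1 y.1
  comp_id x y := e_comp_id V x.1 y.1
  assoc x y z t := e_assoc V x.1 y.1 z.1 t.1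

/-- The inclusion of a full sub-`V`-category. -/
def fullSubIncl (S : Set C) : EnrichedFunctor V S C where
  obj x := x.1
  map x y := 𝟙 (x.1 ⟶[V] y.1)
  map_id x := Category.comp_id _
  map_comp x y z := by
    erw [Category.comp_id, id_tensorHom_id, Category.id_comp]
    rfl

end FullSub

section Op

variable [BraidedCategory V] {C : Type u₁} [EnrichedCategory V C]
  {D : Type u₂} [EnrichedCategory V D]

/-- The opposite of a `V`-functor. -/
def opFunctor (F : EnrichedFunctor V C D) : EnrichedFunctor V Cᵒᵖ Dᵒᵖ where
  obj x := op (F.obj x.unop)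
  map x y := F.map y.unop x.unop
  map_id x := F.map_id x.unop
  map_comp x y z := by
    rw [tensorHom_eComp_op_eq, eComp_op_eq, Category.assoc]
    erw [F.map_comp]
    rfl

end Op

variable [MonoidalClosed V]

theorem uncurry_tensor_comp {A B x y z : V} (f : A ⟶ (ihom x).obj y) (g : B ⟶ (ihom y).obj z) :
    MonoidalClosed.uncurry ((f ⊗ₘ g) ≫ MonoidalClosed.comp x y z) =
      (α_ x A B).inv ≫ MonoidalClosed.uncurry f ▷ B ≫ MonoidalClosed.uncurry g := by
  rw [MonoidalClosed.comp_eq, MonoidalClosed.uncurry_natural_left, MonoidalClosed.uncurry_curry,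
    MonoidalClosed.compTranspose_eq, MonoidalClosed.uncurry_eq, MonoidalClosed.uncurry_eq,
    MonoidalCategory.tensorHom_def]
  simp only [MonoidalCategory.whiskerLeft_comp, Category.assoc, comp_whiskerRight]
  rw [associator_inv_naturality_right_assoc, whisker_exchange_assoc,
    associator_inv_naturality_middle_assoc]
  rfl

theorem uncurry_comp_pre {A x x' y : V} (h : x' ⟶ x) (f : A ⟶ (ihom x).obj y) :
    MonoidalClosed.uncurry (f ≫ (MonoidalClosed.pre h).app y) =
      h ▷ A ≫ MonoidalClosed.uncurry f := by
  rw [MonoidalClosed.uncurry_natural_left, MonoidalClosed.uncurry_pre,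
    MonoidalClosed.uncurry_eq, whisker_exchange_assoc]

theorem tensor_comp_pre {A B x x' y z : V} (h : x' ⟶ x) (f : A ⟶ (ihom x).obj y)
    (g : B ⟶ (ihom y).obj z) :
    ((f ⊗ₘ g) ≫ MonoidalClosed.comp x y z) ≫ (MonoidalClosed.pre h).app z =
      ((f ≫ (MonoidalClosed.pre h).app y) ⊗ₘ g) ≫ MonoidalClosed.comp x' y z := by
  apply MonoidalClosed.uncurry_injective
  rw [uncurry_comp_pre, uncurry_tensor_comp, uncurry_tensor_comp, uncurry_comp_pre]
  simp

theorem tensor_comp_map {A B x y z z' : V} (h : z ⟶ z') (f : A ⟶ (ihom x).obj y)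
    (g : B ⟶ (ihom y).obj z) :
    ((f ⊗ₘ g) ≫ MonoidalClosed.comp x y z) ≫ (ihom x).map h =
      (f ⊗ₘ (g ≫ (ihom y).map h)) ≫ MonoidalClosed.comp x y z' := by
  apply MonoidalClosed.uncurry_injective
  rw [MonoidalClosed.uncurry_natural_right, uncurry_tensor_comp, uncurry_tensor_comp,
    MonoidalClosed.uncurry_natural_right]
  simp

theorem tensor_map_pre {A B x y y' z : V} (h : y ⟶ y') (f : A ⟶ (ihom x).obj y)
    (g : B ⟶ (ihom y').obj z) :
    ((f ≫ (ihom x).map h) ⊗ₘ g) ≫ MonoidalClosed.comp x y' z =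
      (f ⊗ₘ (g ≫ (MonoidalClosed.pre h).app z)) ≫ MonoidalClosed.comp x y z := by
  apply MonoidalClosed.uncurry_injective
  rw [uncurry_tensor_comp, uncurry_tensor_comp, MonoidalClosed.uncurry_natural_right,
    uncurry_comp_pre]
  simp [whisker_exchange_assoc]

section Act

variable {C : Type u₁} [EnrichedCategory V C]

/-- The action `F x ⊗ C(x, y) ⟶ F y` of a `V`-valued `V`-functor on homs. -/
def act (F : EnrichedFunctor V C V) (x y : C) : F.obj x ⊗ (x ⟶[V] y) ⟶ F.obj y :=
  MonoidalClosed.uncurry (F.map x y)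

theorem act_id (F : EnrichedFunctor V C V) (x : C) :
    F.obj x ◁ eId V x ≫ act F x x = (ρ_ (F.obj x)).hom := by
  rw [act, ← MonoidalClosed.uncurry_natural_left]
  erw [F.map_id]
  exact MonoidalClosed.uncurry_curry _

theorem act_comp (F : EnrichedFunctor V C V) (x y z : C) :
    F.obj x ◁ eComp V x y z ≫ act F x z =
      (α_ _ _ _).inv ≫ act F x y ▷ _ ≫ act F y z := by
  rw [act, ← MonoidalClosed.uncurry_natural_left]
  erw [F.map_comp]
  exact uncurry_tensor_comp _ _

/-- A `V`-valued `V`-functor from its action on homs. -/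
def ofAct (obj : C → V) (m : ∀ x y, obj x ⊗ (x ⟶[V] y) ⟶ obj y)
    (hid : ∀ x, obj x ◁ eId V x ≫ m x x = (ρ_ (obj x)).hom)
    (hcomp : ∀ x y z, obj x ◁ eComp V x y z ≫ m x z = (α_ _ _ _).inv ≫ m x y ▷ _ ≫ m y z) :
    EnrichedFunctor V C V where
  obj := obj
  map x y := MonoidalClosed.curry (m x y)
  map_id x := by
    rw [← MonoidalClosed.curry_natural_left, hid]
    rfl
  map_comp x y z := by
    apply MonoidalClosed.uncurry_injective
    refine Eq.trans ?_ (uncurry_tensor_comp _ _).symm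
    rw [MonoidalClosed.uncurry_natural_left, MonoidalClosed.uncurry_curry,
      MonoidalClosed.uncurry_curry, MonoidalClosed.uncurry_curry, hcomp]

theorem act_ofAct (obj : C → V) (m : ∀ x y, obj x ⊗ (x ⟶[V] y) ⟶ obj y) (hid) (hcomp) (x y : C) :
    act (ofAct obj m hid hcomp) x y = m x y :=
  MonoidalClosed.uncurry_curry _

/-- The representable `V`-functor `C(c, -) : C ⟶ V`. For `C = Lᵒᵖ` and `c = op l`, this is the
presheaf `L(-, l)`. -/
def representable (c : C) : EnrichedFunctor V C V :=
  ofAct (fun x ↦ c ⟶[V] x) (fun x y ↦ eComp V c x y)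
    (fun x ↦ by rw [← cancel_epi (ρ_ (c ⟶[V] x)).inv, e_comp_id, Iso.inv_hom_id])
    (fun x y z ↦ (e_assoc V c x y z).symm)

variable {D : Type u₂} [EnrichedCategory V D]

theorem act_precomp (J : EnrichedFunctor V C D) (F : EnrichedFunctor V D V) (x y : C) :
    act (J.comp V F) x y = F.obj (J.obj x) ◁ J.map x y ≫ act F (J.obj x) (J.obj y) :=
  MonoidalClosed.uncurry_natural_left _ _

/-- `V`-naturality of a family of maps `G x ⟶ H x`. -/
def IsNatural (G H : EnrichedFunctor V C V) (η : ∀ x, G.obj x ⟶ H.obj x) : Prop :=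
  ∀ x y, act G x y ≫ η y = η x ▷ (x ⟶[V] y) ≫ act H x y

/-- A family `f c : G c ⊗ D(J c, d) ⟶ X` is a cowedge if it is `V`-extranatural in `c`: the two
maps `G c ⊗ C(c, c') ⊗ D(J c', d) ⟶ X` agree. -/
def IsCowedge (J : EnrichedFunctor V C D) (G : EnrichedFunctor V C V) (d : D) {X : V}
    (f : ∀ c, G.obj c ⊗ (J.obj c ⟶[V] d) ⟶ X) : Prop :=
  ∀ c c', G.obj c ◁ (J.map c c' ▷ (J.obj c' ⟶[V] d) ≫ eComp V (J.obj c) (J.obj c') d) ≫ f c =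
    (α_ _ _ _).inv ≫ act G c c' ▷ (J.obj c' ⟶[V] d) ≫ f c'

/-- `η : G ⟶ L J` exhibits `L : D ⟶ V` as the (pointwise) left Kan extension of `G : C ⟶ V` along
`J : C ⟶ D`: it is `V`-natural, and for each `d` the maps
`G c ⊗ D(J c, d) ⟶ L (J c) ⊗ D(J c, d) ⟶ L d` exhibit `L d` as the coend `∫^c G c ⊗ D(J c, d)`. -/
structure IsLeftKan (J : EnrichedFunctor V C D) (G : EnrichedFunctor V C V)
    (L : EnrichedFunctor V D V) (η : ∀ c, G.obj c ⟶ L.obj (J.obj c)) : Prop where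
  natural : IsNatural G (J.comp V L) η
  universal : ∀ (d : D) (X : V) (f : ∀ c, G.obj c ⊗ (J.obj c ⟶[V] d) ⟶ X), IsCowedge J G d f →
    ∃! g : L.obj d ⟶ X, ∀ c, η c ▷ (J.obj c ⟶[V] d) ≫ act L (J.obj c) d ≫ g = f c

/-- `F : C ⟶ V` is small if it is the left Kan extension of its restriction to some small full
subcategory. -/
def IsSmall (F : EnrichedFunctor V C V) : Prop :=
  ∃ S : Set C, Small.{w} S ∧
    IsLeftKan (fullSubIncl S) ((fullSubIncl S).comp V F) F (fun _ ↦ 𝟙 _)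

end Act
end General

section Graded

variable {V : Type u} [Category.{w} V] [MonoidalCategory V] [SymmetricCategory V]
  [MonoidalClosed V] {C : Type u₁} [EnrichedCategory V C] {D : Type u₂} [EnrichedCategory V D]

/-- A family `a x : A ⟶ [F x, G x]` is `V`-natural (extranatural) in `x`: the two maps
`A ⊗ C(x, y) ⟶ [F x, G y]` agree. -/
def IsNatFamily (F G : EnrichedFunctor V C V) {A : V}
    (a : ∀ x, A ⟶ (ihom (F.obj x)).obj (G.obj x)) : Prop :=
  ∀ x y : C, (β_ A (x ⟶[V] y)).hom ≫ (F.map x y ⊗ₘ a y) ≫ MonoidalClosed.comp _ _ _ =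
    (a x ⊗ₘ G.map x y) ≫ MonoidalClosed.comp _ _ _

/-- `E` with `π` is the object of `V`-natural transformations `∫_x [F x, G x]`: the universal
`V`-natural family. -/
structure IsNatObject (F G : EnrichedFunctor V C V) (E : V)
    (π : ∀ x, E ⟶ (ihom (F.obj x)).obj (G.obj x)) : Prop where
  natural : IsNatFamily F G π
  universal : ∀ (A : V) (a : ∀ x, A ⟶ (ihom (F.obj x)).obj (G.obj x)), IsNatFamily F G a →
    ∃! f : A ⟶ E, ∀ x, f ≫ π x = a x

/-- The transpose `A ⊗ F x ⟶ G x` of a map `A ⟶ [F x, G x]`. -/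
def tform {A : V} (F G : EnrichedFunctor V C V) (a : ∀ x, A ⟶ (ihom (F.obj x)).obj (G.obj x)) (x : C) :
   A ⊗ F.obj x ⟶ G.obj x := (β_ A (F.obj x)).hom ≫ MonoidalClosed.uncurry (a x)

theorem graded_iff {A : V} (F G : EnrichedFunctor V C V)
    (a : ∀ x, A ⟶ (ihom (F.obj x)).obj (G.obj x)) (x y : C) :
    ((β_ A (x ⟶[V] y)).hom ≫ (F.map x y ⊗ₘ a y) ≫ MonoidalClosed.comp _ _ _ =
        (a x ⊗ₘ G.map x y) ≫ MonoidalClosed.comp _ _ _) ↔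
      (α_ _ _ _).inv ≫ tform F G a x ▷ _ ≫ act G x y = A ◁ act F x y ≫ tform F G a y := by
  rw [← MonoidalClosed.uncurry_injective.eq_iff, MonoidalClosed.uncurry_natural_left]
  erw [uncurry_tensor_comp, uncurry_tensor_comp]
  change _ ◁ _ ≫ (α_ _ _ _).inv ≫ act F x y ▷ _ ≫ _ = _ ≫ _ ≫ act G x y ↔ _
  rw [← cancel_epi ((α_ A (F.obj x) (x ⟶[V] y)).inv ≫ (β_ A (F.obj x)).hom ▷ (x ⟶[V] y) ≫
    (α_ _ _ _).hom), eq_comm]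
  have h : ((α_ A (F.obj x) (x ⟶[V] y)).inv ≫ (β_ A (F.obj x)).hom ▷ (x ⟶[V] y) ≫
    (α_ _ _ _).hom) ≫ F.obj x ◁ (β_ A (x ⟶[V] y)).hom ≫ (α_ _ _ _).inv =
      (β_ A (F.obj x ⊗ (x ⟶[V] y))).hom := by
    simp [BraidedCategory.braiding_tensor_right_hom]
  have h2 := (reassoc_of% h) (act F x y ▷ A ≫ MonoidalClosed.uncurry (a y))
  simp only [Category.assoc]
  rw [h2]
  simp [tform]

theorem IsNatFamily.precomp (J : EnrichedFunctor V C D) {F G : EnrichedFunctor V D V} {A : V}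
    {a : ∀ x, A ⟶ (ihom (F.obj x)).obj (G.obj x)} (ha : IsNatFamily F G a) :
    IsNatFamily (J.comp V F) (J.comp V G) (fun x ↦ a (J.obj x)) := fun x y ↦ by
  have h := A ◁ J.map x y ≫= ha (J.obj x) (J.obj y)
  rw [BraidedCategory.braiding_naturality_right_assoc, ← tensorHom_id, ← id_tensorHom,
    tensorHom_comp_tensorHom_assoc, tensorHom_comp_tensorHom_assoc, Category.id_comp,
    Category.id_comp] at h
  exact h

theorem IsNatFamily.precomp_hom {F G : EnrichedFunctor V C V} {A B : V}
    {a : ∀ x, A ⟶ (ihom (F.obj x)).obj (G.obj x)} (ha : IsNatFamily F G a) (f : B ⟶ A) :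
    IsNatFamily F G (fun x ↦ f ≫ a x) := fun x y ↦ by
  have h := f ▷ _ ≫= ha x y
  rw [BraidedCategory.braiding_naturality_left_assoc, ← tensorHom_id, ← id_tensorHom,
    tensorHom_comp_tensorHom_assoc, tensorHom_comp_tensorHom_assoc, Category.id_comp,
    Category.id_comp] at h
  exact h

section Kan

variable {J : EnrichedFunctor V C D} {G : EnrichedFunctor V C V} {L : EnrichedFunctor V D V}
  {η : ∀ c, G.obj c ⟶ L.obj (J.obj c)}

theorem kan_act (η : ∀ c, G.obj c ⟶ L.obj (J.obj c)) (c : C) (x y : D) :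
    (η c ▷ (J.obj c ⟶[V] x) ≫ act L (J.obj c) x) ▷ (x ⟶[V] y) ≫ act L x y =
      (α_ _ _ _).hom ≫ G.obj c ◁ eComp V (J.obj c) x y ≫
        η c ▷ (J.obj c ⟶[V] y) ≫ act L (J.obj c) y := by
  rw [whisker_exchange_assoc, act_comp]
  simp

theorem unit_act {X : V} (H : EnrichedFunctor V D V) {d : D} (f : X ⟶ H.obj d) :
    (ρ_ X).inv ≫ X ◁ eId V d ≫ f ▷ (d ⟶[V] d) ≫ act H d d = f := by
  rw [whisker_exchange_assoc, act_id]
  simp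

theorem IsLeftKan.natural' (h : IsLeftKan J G L η) (c c' : C) :
    act G c c' ≫ η c' =
      η c ▷ (c ⟶[V] c') ≫ L.obj (J.obj c) ◁ J.map c c' ≫ act L (J.obj c) (J.obj c') := by
  rw [← act_precomp]
  exact h.natural c c'

theorem IsLeftKan.cowedge (h : IsLeftKan J G L η) (d : D) (c c' : C) :
    G.obj c ◁ (J.map c c' ▷ (J.obj c' ⟶[V] d) ≫ eComp V (J.obj c) (J.obj c') d) ≫
        η c ▷ (J.obj c ⟶[V] d) ≫ act L (J.obj c) d =
      (α_ _ _ _).inv ≫ act G c c' ▷ (J.obj c' ⟶[V] d) ≫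
        η c' ▷ (J.obj c' ⟶[V] d) ≫ act L (J.obj c') d := by
  have := h.natural' c c'
  rw [← comp_whiskerRight_assoc, this, whisker_exchange_assoc,
    MonoidalCategory.whiskerLeft_comp_assoc, act_comp]
  simp

theorem IsLeftKan.hom_ext (h : IsLeftKan J G L η) {d : D} {X : V} {g g' : L.obj d ⟶ X}
    (w : ∀ c, η c ▷ (J.obj c ⟶[V] d) ≫ act L (J.obj c) d ≫ g =
      η c ▷ (J.obj c ⟶[V] d) ≫ act L (J.obj c) d ≫ g') : g = g' := by
  refine (h.universal d X (fun c ↦ η c ▷ (J.obj c ⟶[V] d) ≫ act L (J.obj c) d ≫ g')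
    (fun c c' ↦ ?_)).unique w (fun c ↦ rfl)
  have := h.cowedge d c c' =≫ g'
  simpa using this

theorem IsLeftKan.hom_ext_left (h : IsLeftKan J G L η) {d : D} {A X : V} {g g' : A ⊗ L.obj d ⟶ X}
    (w : ∀ c, A ◁ (η c ▷ (J.obj c ⟶[V] d) ≫ act L (J.obj c) d) ≫ g =
      A ◁ (η c ▷ (J.obj c ⟶[V] d) ≫ act L (J.obj c) d) ≫ g') : g = g' := by
  apply MonoidalClosed.curry_injective
  refine h.hom_ext fun c ↦ ?_
  simpa [MonoidalClosed.curry_natural_left] using congr_arg MonoidalClosed.curry (w c)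

theorem IsLeftKan.hom_ext_right (h : IsLeftKan J G L η) {d : D} {A X : V} {g g' : L.obj d ⊗ A ⟶ X}
    (w : ∀ c, (η c ▷ (J.obj c ⟶[V] d) ≫ act L (J.obj c) d) ▷ A ≫ g =
      (η c ▷ (J.obj c ⟶[V] d) ≫ act L (J.obj c) d) ▷ A ≫ g') : g = g' := by
  rw [← cancel_epi (β_ A (L.obj d)).hom]
  refine h.hom_ext_left fun c ↦ ?_
  rw [BraidedCategory.braiding_naturality_right_assoc,
    BraidedCategory.braiding_naturality_right_assoc, w]

theorem IsLeftKan.exists_tform (h : IsLeftKan J G L η) (H : EnrichedFunctor V D V) {A : V}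
    (t : ∀ c, A ⊗ G.obj c ⟶ H.obj (J.obj c))
    (ht : ∀ x y, (α_ _ _ _).inv ≫ t x ▷ _ ≫ act (J.comp V H) x y = A ◁ act G x y ≫ t y) :
    ∃ t' : ∀ d, A ⊗ L.obj d ⟶ H.obj d,
      (∀ x y, (α_ _ _ _).inv ≫ t' x ▷ _ ≫ act H x y = A ◁ act L x y ≫ t' y) ∧
      ∀ c, A ◁ η c ≫ t' (J.obj c) = t c := by
  have key : ∀ d, ∃ g : A ⊗ L.obj d ⟶ H.obj d, ∀ c,
      A ◁ (η c ▷ (J.obj c ⟶[V] d) ≫ act L (J.obj c) d) ≫ g =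
        (α_ _ _ _).inv ≫ t c ▷ _ ≫ act H (J.obj c) d := fun d ↦ by
    obtain ⟨g, hg, -⟩ := h.universal d ((ihom A).obj (H.obj d))
      (fun c ↦ MonoidalClosed.curry ((α_ _ _ _).inv ≫ t c ▷ _ ≫ act H (J.obj c) d))
      (fun c c' ↦ by
        rw [← MonoidalClosed.curry_natural_left, ← MonoidalClosed.curry_natural_left,
          ← MonoidalClosed.curry_natural_left]
        apply congrArg (MonoidalClosed.curry (A := A))
        have h1 : (α_ _ _ _).inv ≫ t c ▷ _ ≫ H.obj (J.obj c) ◁ J.map c c' ≫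
            act H (J.obj c) (J.obj c') = A ◁ act G c c' ≫ t c' := by
          rw [← act_precomp]
          exact ht c c'
        have h2 := congrArg (fun z ↦ (α_ _ _ _).hom ▷ _ ≫ z ▷ (J.obj c' ⟶[V] d)) h1
        simp only [comp_whiskerRight, Category.assoc, hom_inv_whiskerRight_assoc] at h2
        rw [associator_inv_naturality_right_assoc, whisker_exchange_assoc,
          MonoidalCategory.whiskerLeft_comp, Category.assoc, act_comp]
        have h3 := h2 =≫ act H (J.obj c') d
        simp only [Category.assoc] at h3
        rw [associator_inv_naturality_middle_assoc, associator_inv_naturality_middle_assoc,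
          associator_inv_naturality_left_assoc, h3]
        simp)
    refine ⟨MonoidalClosed.uncurry g, fun c ↦ ?_⟩
    rw [← MonoidalClosed.uncurry_natural_left, Category.assoc, hg, MonoidalClosed.uncurry_curry]
  choose t' ht' using key
  refine ⟨t', fun x y ↦ ?_, fun c ↦ ?_⟩
  · apply MonoidalClosed.curry_injective
    refine h.hom_ext_right fun c ↦ ?_
    rw [← MonoidalClosed.curry_natural_left, ← MonoidalClosed.curry_natural_left]
    apply congrArg (MonoidalClosed.curry (A := A))
    rw [← MonoidalCategory.whiskerLeft_comp_assoc A _ (act L x y), kan_act,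
      associator_inv_naturality_middle_assoc, ← comp_whiskerRight_assoc, ht' x c,
      MonoidalCategory.whiskerLeft_comp, MonoidalCategory.whiskerLeft_comp, Category.assoc,
      Category.assoc, ht' y c, associator_inv_naturality_right_assoc, whisker_exchange_assoc,
      act_comp]
    simp
  · have h1 := (A ◁ ((ρ_ _).inv ≫ _ ◁ eId V (J.obj c))) ≫= ht' (J.obj c) c
    rw [← MonoidalCategory.whiskerLeft_comp_assoc, Category.assoc, unit_act] at h1
    rw [h1]
    refine Eq.trans ?_ (unit_act H (t c))
    simp

theorem tform_comp_pre {A : V} (c : C) (H : EnrichedFunctor V D V)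
    (a : ∀ x, A ⟶ (ihom (L.obj x)).obj (H.obj x)) :
    A ◁ η c ≫ tform L H a (J.obj c) = (β_ A (G.obj c)).hom ≫
      MonoidalClosed.uncurry (a (J.obj c) ≫ (MonoidalClosed.pre (η c)).app _) := by
  rw [uncurry_comp_pre, tform, BraidedCategory.braiding_naturality_right_assoc]

theorem IsLeftKan.natFamily_ext (h : IsLeftKan J G L η) {H : EnrichedFunctor V D V} {A : V}
    {a a' : ∀ x, A ⟶ (ihom (L.obj x)).obj (H.obj x)} (ha : IsNatFamily L H a)
    (ha' : IsNatFamily L H a') (w : ∀ c,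
      a (J.obj c) ≫ (MonoidalClosed.pre (η c)).app (H.obj (J.obj c)) =
        a' (J.obj c) ≫ (MonoidalClosed.pre (η c)).app (H.obj (J.obj c))) : a = a' := by
  have key : ∀ (a : ∀ x, A ⟶ (ihom (L.obj x)).obj (H.obj x)) (_ : IsNatFamily L H a) (c : C) (d : D),
      A ◁ (η c ▷ (J.obj c ⟶[V] d) ≫ act L (J.obj c) d) ≫ tform L H a d =
        (α_ _ _ _).inv ≫ ((β_ A (G.obj c)).hom ≫ MonoidalClosed.uncurry
          (a (J.obj c) ≫ (MonoidalClosed.pre (η c)).app (H.obj (J.obj c)))) ▷ _ ≫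
            act H (J.obj c) d := fun a ha c d ↦ by
    have h1 := (graded_iff L H a (J.obj c) d).1 (ha (J.obj c) d)
    have h2 := tform_comp_pre (η := η) c H a
    rw [MonoidalCategory.whiskerLeft_comp, Category.assoc, ← h1, ← h2]
    simp
  have h3 : ∀ d, tform L H a d = tform L H a' d := fun d ↦
    h.hom_ext_left fun c ↦ by
      rw [key a ha, key a' ha', w]
  ext d
  have h4 := h3 d
  rw [tform, tform, cancel_epi] at h4
  exact MonoidalClosed.uncurry_injective h4

theorem IsLeftKan.exists_natFamily (h : IsLeftKan J G L η) (H : EnrichedFunctor V D V) {A : V}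
    {b : ∀ c, A ⟶ (ihom (G.obj c)).obj (H.obj (J.obj c))}
    (hb : IsNatFamily G (J.comp V H) b) :
    ∃ a : ∀ x, A ⟶ (ihom (L.obj x)).obj (H.obj x), IsNatFamily L H a ∧ ∀ c,
      a (J.obj c) ≫ (MonoidalClosed.pre (η c)).app (H.obj (J.obj c)) = b c := by
  obtain ⟨t', ht', ht''⟩ := h.exists_tform H (A := A) (tform G (J.comp V H) b)
    (fun x y ↦ (graded_iff G (J.comp V H) b x y).1 (hb x y))
  have e : tform L H (fun d ↦ MonoidalClosed.curry ((β_ A (L.obj d)).inv ≫ t' d)) = t' := by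
    ext d
    simp [tform]
  refine ⟨fun d ↦ MonoidalClosed.curry ((β_ A (L.obj d)).inv ≫ t' d), fun x y ↦
    (graded_iff L H _ x y).2 (by rw [e, ht']), fun c ↦ ?_⟩
  apply MonoidalClosed.uncurry_injective
  rw [← cancel_epi (β_ A (G.obj c)).hom]
  refine (tform_comp_pre (η := η) c H
    (fun d ↦ MonoidalClosed.curry ((β_ A (L.obj d)).inv ≫ t' d))).symm.trans ?_
  rw [e]
  exact ht'' c

end Kan

theorem exists_coend [HasColimitsOfSize.{w, w} V] [Small.{w} C] (J : EnrichedFunctor V C D)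
    (G : EnrichedFunctor V C V) (d : D) :
    ∃ (X : V) (q : ∀ c, G.obj c ⊗ (J.obj c ⟶[V] d) ⟶ X), IsCowedge J G d q ∧
      ∀ (Y : V) (f : ∀ c, G.obj c ⊗ (J.obj c ⟶[V] d) ⟶ Y), IsCowedge J G d f →
        ∃! g : X ⟶ Y, ∀ c, q c ≫ g = f c := by
  have h1 : ∀ (α : Type u₁) [Small.{w} α], HasCoproductsOfShape α V := fun α _ ↦
    hasColimitsOfShape_of_equivalence (Discrete.equivalence (equivShrink.{w} α).symm)
  have := h1 C
  have := h1 (C × C)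
  let P := ∐ fun c : C ↦ G.obj c ⊗ (J.obj c ⟶[V] d)
  let l : (∐ fun p : C × C ↦ G.obj p.1 ⊗ (p.1 ⟶[V] p.2) ⊗ (J.obj p.2 ⟶[V] d)) ⟶ P :=
    Sigma.desc fun p ↦ G.obj p.1 ◁ (J.map p.1 p.2 ▷ (J.obj p.2 ⟶[V] d) ≫
      eComp V (J.obj p.1) (J.obj p.2) d) ≫ Sigma.ι (fun c : C ↦ G.obj c ⊗ (J.obj c ⟶[V] d)) p.1
  let r : (∐ fun p : C × C ↦ G.obj p.1 ⊗ (p.1 ⟶[V] p.2) ⊗ (J.obj p.2 ⟶[V] d)) ⟶ P :=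
    Sigma.desc fun p ↦ (α_ _ _ _).inv ≫ act G p.1 p.2 ▷ (J.obj p.2 ⟶[V] d) ≫
      Sigma.ι (fun c : C ↦ G.obj c ⊗ (J.obj c ⟶[V] d)) p.2
  have key : ∀ {Y : V} (f : P ⟶ Y), l ≫ f = r ≫ f ↔
      IsCowedge J G d (fun c ↦ Sigma.ι (fun c : C ↦ G.obj c ⊗ (J.obj c ⟶[V] d)) c ≫ f) :=
    fun {Y} f ↦ by
    have : l ≫ f = r ≫ f ↔ ∀ z, Sigma.ι _ z ≫ l ≫ f = Sigma.ι _ z ≫ r ≫ f :=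
      ⟨fun h z ↦ by rw [h], fun h ↦ Sigma.hom_ext _ _ h⟩
    rw [this, Prod.forall]
    refine forall_congr' fun c ↦ forall_congr' fun c' ↦ ?_
    simp [l, r]
  refine ⟨coequalizer l r, fun c ↦ Sigma.ι (fun c : C ↦ G.obj c ⊗ (J.obj c ⟶[V] d)) c ≫
    coequalizer.π l r, (key _).1 (coequalizer.condition l r), fun Y f hf ↦
    ⟨coequalizer.desc (Sigma.desc f) ((key _).2 (by simpa using hf)), fun c ↦ by simp,
      fun g hg ↦ coequalizer.hom_ext (Sigma.hom_ext _ _ fun c ↦ by simpa using hg c)⟩⟩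

theorem exists_leftKan_of_small [HasColimitsOfSize.{w, w} V] [Small.{w} C]
    (J : EnrichedFunctor V C D) (G : EnrichedFunctor V C V) :
    ∃ (L : EnrichedFunctor V D V) (η : _), IsLeftKan J G L η := by
  choose L q hq hu using exists_coend J G
  have ext : ∀ {d : D} {Z Y : V} {f g : L d ⊗ Z ⟶ Y},
      (∀ c, q d c ▷ Z ≫ f = q d c ▷ Z ≫ g) → f = g := fun {d Z Y f g} h ↦ by
    rw [← cancel_epi (β_ Z (L d)).hom]
    apply MonoidalClosed.curry_injective
    have e : ∀ f : L d ⊗ Z ⟶ Y, ∀ c, q d c ≫ MonoidalClosed.curry ((β_ Z (L d)).hom ≫ f) =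
        MonoidalClosed.curry ((β_ Z _).hom ≫ q d c ▷ Z ≫ f) := fun f c ↦ by
      rw [← MonoidalClosed.curry_natural_left, BraidedCategory.braiding_naturality_right_assoc]
    refine (hu d _ _ ?_).unique (fun c ↦ e f c) (fun c ↦ ?_)
    · intro c c'
      simp only [← e]
      have := hq d c c' =≫ MonoidalClosed.curry ((β_ Z (L d)).hom ≫ f)
      simpa only [Category.assoc] using this
    · rw [e, h]
  have exm : ∀ d d', ∃ m : L d ⊗ (d ⟶[V] d') ⟶ L d', ∀ c,
      q d c ▷ (d ⟶[V] d') ≫ m = (α_ _ _ _).hom ≫ G.obj c ◁ eComp V (J.obj c) d d' ≫ q d' c :=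
    fun d d' ↦ by
    obtain ⟨g, hg, -⟩ := hu d ((ihom (d ⟶[V] d')).obj (L d')) (fun c ↦
      MonoidalClosed.curry ((β_ _ _).hom ≫
        (α_ _ _ _).hom ≫ G.obj c ◁ eComp V (J.obj c) d d' ≫ q d' c)) (fun c c' ↦ by
      rw [← MonoidalClosed.curry_natural_left, ← MonoidalClosed.curry_natural_left,
        ← MonoidalClosed.curry_natural_left]
      apply congrArg (MonoidalClosed.curry (A := (d ⟶[V] d')))
      simp only [BraidedCategory.braiding_naturality_right_assoc]
      rw [cancel_epi]
      have h1 := hq d' c c'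
      have h2 : (J.map c c' ▷ (J.obj c' ⟶[V] d) ≫ eComp V (J.obj c) (J.obj c') d) ▷ (d ⟶[V] d') ≫
          eComp V (J.obj c) d d' = (α_ _ _ _).hom ≫ (c ⟶[V] c') ◁ eComp V (J.obj c') d d' ≫
            J.map c c' ▷ (J.obj c' ⟶[V] d') ≫ eComp V (J.obj c) (J.obj c') d' := by
        rw [comp_whiskerRight, Category.assoc, ← e_assoc', whisker_exchange_assoc]
        simp
      rw [whisker_assoc, Category.assoc, Category.assoc, Iso.inv_hom_id_assoc,
        ← MonoidalCategory.whiskerLeft_comp_assoc, h2]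
      simp only [MonoidalCategory.whiskerLeft_comp, Category.assoc] at h1 ⊢
      rw [h1, associator_inv_naturality_right_assoc, whisker_exchange_assoc]
      simp)
    refine ⟨(β_ _ _).hom ≫ MonoidalClosed.uncurry g, fun c ↦ ?_⟩
    rw [BraidedCategory.braiding_naturality_left_assoc, ← MonoidalClosed.uncurry_natural_left,
      hg, MonoidalClosed.uncurry_curry, SymmetricCategory.symmetry_assoc]
  choose m hm using exm
  let L' : EnrichedFunctor V D V := ofAct L m
    (fun d ↦ by
      rw [← cancel_epi (ρ_ (L d)).inv, Iso.inv_hom_id]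
      refine (hu d _ _ (hq d)).unique (fun c ↦ ?_) (fun c ↦ Category.comp_id _)
      rw [rightUnitor_inv_naturality_assoc, ← whisker_exchange_assoc, hm]
      have h := congrArg (fun z ↦ G.obj c ◁ z ≫ q d c) (e_comp_id V (J.obj c) d)
      simp only [MonoidalCategory.whiskerLeft_comp, Category.assoc,
        MonoidalCategory.whiskerLeft_id, Category.id_comp] at h
      simpa using h)
    (fun x y z ↦ ext fun c ↦ by
      rw [← whisker_exchange_assoc, hm, associator_inv_naturality_left_assoc,
        ← comp_whiskerRight_assoc, hm]
      simp only [comp_whiskerRight, Category.assoc, whisker_assoc, Iso.inv_hom_id_assoc, hm]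
      rw [← MonoidalCategory.whiskerLeft_comp_assoc _ (_ ▷ _), ← e_assoc']
      simp)
  let η : ∀ c, G.obj c ⟶ L (J.obj c) := fun c ↦
    (ρ_ _).inv ≫ G.obj c ◁ eId V (J.obj c) ≫ q (J.obj c) c
  have hη : ∀ c d, η c ▷ (J.obj c ⟶[V] d) ≫ m (J.obj c) d = q d c := fun c d ↦ by
    simp only [η, comp_whiskerRight, Category.assoc, hm]
    have h := congrArg (fun z ↦ G.obj c ◁ z ≫ q d c) (e_id_comp V (J.obj c) d)
    simp only [MonoidalCategory.whiskerLeft_comp, Category.assoc,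
      MonoidalCategory.whiskerLeft_id, Category.id_comp] at h
    simpa using h
  have hL : ∀ x y, act L' x y = m x y := fun x y ↦ act_ofAct _ _ _ _ _ _
  have hnat : ∀ c c', act G c c' ≫ η c' =
      η c ▷ (c ⟶[V] c') ≫ L (J.obj c) ◁ J.map c c' ≫ m (J.obj c) (J.obj c') := fun c c' ↦ by
    have h1 := hq (J.obj c') c c'
    rw [← whisker_exchange_assoc]
    rw [hη]
    simp only [η]
    rw [rightUnitor_inv_naturality_assoc, ← whisker_exchange_assoc]
    rw [Iso.eq_inv_comp] at h1
    rw [← h1]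
    have h2 : (c ⟶[V] c') ◁ eId V (J.obj c') ≫ J.map c c' ▷ _ ≫
        eComp V (J.obj c) (J.obj c') (J.obj c') = (ρ_ _).hom ≫ J.map c c' := by
      rw [whisker_exchange_assoc, ← Iso.inv_comp_eq, ← rightUnitor_inv_naturality_assoc,
        e_comp_id, Category.comp_id]
    have h := congrArg (fun z ↦ G.obj c ◁ z ≫ q _ c) h2
    simp only [MonoidalCategory.whiskerLeft_comp, Category.assoc] at h
    simp [h]
  refine ⟨L', η, fun c c' ↦ ?_, fun d X f hf ↦ ?_⟩
  · rw [act_precomp, hL]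
    exact hnat c c'
  · have : ∀ g : L d ⟶ X, ∀ c, η c ▷ (J.obj c ⟶[V] d) ≫ act L' (J.obj c) d ≫ g = q d c ≫ g :=
      fun g c ↦ by rw [hL, ← hη c d, Category.assoc]; rfl
    obtain ⟨g, hg, hg'⟩ := hu d X f hf
    exact ⟨g, fun c ↦ (this g c).trans (hg c), fun g' h' ↦ hg' g' fun c ↦ (this g' c).symm.trans (h' c)⟩

section Factor

variable {E : Type u₃} [EnrichedCategory V E] {I : EnrichedFunctor V E C}
  {J : EnrichedFunctor V C D} {G : EnrichedFunctor V E V} {P : EnrichedFunctor V C V}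
  {L : EnrichedFunctor V D V} {η₁ : ∀ e, G.obj e ⟶ P.obj (I.obj e)}
  {η₂ : ∀ e, G.obj e ⟶ L.obj (J.obj (I.obj e))}

theorem IsLeftKan.factor (h₁ : IsLeftKan I G P η₁) (h₂ : IsLeftKan (I.comp V J) G L η₂) :
    ∃ η₃, IsLeftKan J P L η₃ := by
  have hn₂ : ∀ x y, act G x y ≫ η₂ y = η₂ x ▷ (x ⟶[V] y) ≫
      L.obj (J.obj (I.obj x)) ◁ (I.map x y ≫ J.map (I.obj x) (I.obj y)) ≫ act L _ _ :=
    fun x y ↦ h₂.natural' x y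
  have hu₂ : ∀ (d : D) (X : V) (f : ∀ e, G.obj e ⊗ (J.obj (I.obj e) ⟶[V] d) ⟶ X),
      (∀ e e', G.obj e ◁ ((I.map e e' ≫ J.map (I.obj e) (I.obj e')) ▷ (J.obj (I.obj e') ⟶[V] d) ≫
          eComp V (J.obj (I.obj e)) (J.obj (I.obj e')) d) ≫ f e =
        (α_ _ _ _).inv ≫ act G e e' ▷ (J.obj (I.obj e') ⟶[V] d) ≫ f e') →
      ∃ g : L.obj d ⟶ X, ∀ e,
        η₂ e ▷ (J.obj (I.obj e) ⟶[V] d) ≫ act L (J.obj (I.obj e)) d ≫ g = f e :=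
    fun d X f hf ↦ (h₂.universal d X f hf).exists
  have hext₂ : ∀ {d : D} {X : V} {g g' : L.obj d ⟶ X},
      (∀ e, η₂ e ▷ (J.obj (I.obj e) ⟶[V] d) ≫ act L (J.obj (I.obj e)) d ≫ g =
        η₂ e ▷ (J.obj (I.obj e) ⟶[V] d) ≫ act L (J.obj (I.obj e)) d ≫ g') → g = g' :=
    fun w ↦ h₂.hom_ext w
  obtain ⟨t', ht', ht''⟩ : ∃ t' : ∀ c, 𝟙_ V ⊗ P.obj c ⟶ L.obj (J.obj c),
      (∀ x y, (α_ _ _ _).inv ≫ t' x ▷ (x ⟶[V] y) ≫ L.obj (J.obj x) ◁ J.map x y ≫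
        act L (J.obj x) (J.obj y) = 𝟙_ V ◁ act P x y ≫ t' y) ∧
      ∀ e, 𝟙_ V ◁ η₁ e ≫ t' (I.obj e) = (λ_ _).hom ≫ η₂ e := by
    obtain ⟨t', ht', ht''⟩ := h₁.exists_tform (J.comp V L) (A := 𝟙_ V)
      (fun e ↦ (λ_ _).hom ≫ η₂ e) (fun x y ↦ by
        rw [act_precomp, act_precomp]
        have := hn₂ x y
        have h : (α_ _ _ _).inv ≫ ((λ_ _).hom ≫ η₂ x) ▷ (x ⟶[V] y) ≫
            L.obj (J.obj (I.obj x)) ◁ I.map x y ≫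
            L.obj (J.obj (I.obj x)) ◁ J.map (I.obj x) (I.obj y) ≫ act L _ _ =
              𝟙_ V ◁ act G x y ≫ (λ_ _).hom ≫ η₂ y := by
          rw [leftUnitor_naturality_assoc, this]
          simp
        exact h)
    refine ⟨t', fun x y ↦ ?_, ht''⟩
    have := ht' x y
    rw [act_precomp] at this
    exact this
  obtain ⟨η₃, hη₃⟩ : ∃ η₃ : ∀ c, P.obj c ⟶ L.obj (J.obj c), ∀ c, η₃ c = (λ_ _).inv ≫ t' c :=
    ⟨_, fun _ ↦ rfl⟩
  have h₄ : ∀ x y, act P x y ≫ η₃ y = η₃ x ▷ (x ⟶[V] y) ≫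
      L.obj (J.obj x) ◁ J.map x y ≫ act L (J.obj x) (J.obj y) := fun x y ↦ by
    rw [hη₃, hη₃, leftUnitor_inv_naturality_assoc, ← ht']
    simp
  have h₅ : ∀ e, η₁ e ≫ η₃ (I.obj e) = η₂ e := fun e ↦ by
    rw [hη₃, leftUnitor_inv_naturality_assoc, ht'', Iso.inv_hom_id_assoc]
  refine ⟨η₃, fun x y ↦ ?_, fun d X f hf ↦ ?_⟩
  · rw [act_precomp]
    exact h₄ x y
  · obtain ⟨g, hg⟩ := hu₂ d X (fun e ↦ η₁ e ▷ _ ≫ f (I.obj e)) (fun e e' ↦ by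
      have h := hf (I.obj e) (I.obj e')
      have h' := h₁.natural' e e'
      rw [← comp_whiskerRight_assoc, h', whisker_exchange_assoc]
      simp only [comp_whiskerRight, MonoidalCategory.whiskerLeft_comp, Category.assoc] at h ⊢
      rw [h]
      simp)
    refine ⟨g, fun c ↦ h₁.hom_ext_right fun e ↦ ?_, fun g' hg' ↦ hext₂ fun e ↦ ?_⟩
    · have h := hf (I.obj e) c
      rw [Iso.eq_inv_comp] at h
      rw [← comp_whiskerRight_assoc, Category.assoc, h₄, ← comp_whiskerRight_assoc, h₅,
        comp_whiskerRight _ (act P _ _), Category.assoc, ← h]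
      have hg1 := hg e
      have h6 : (η₂ e ▷ (J.obj (I.obj e) ⟶[V] J.obj c) ≫ act L (J.obj (I.obj e)) (J.obj c)) ▷
            (J.obj c ⟶[V] d) ≫ act L (J.obj c) d =
          (α_ _ _ _).hom ≫ G.obj e ◁ eComp V (J.obj (I.obj e)) (J.obj c) d ≫
            η₂ e ▷ (J.obj (I.obj e) ⟶[V] d) ≫ act L (J.obj (I.obj e)) d :=
        kan_act (J := I.comp V J) η₂ e (J.obj c) d
      rw [← whisker_exchange_assoc, comp_whiskerRight, Category.assoc, reassoc_of% h6, hg1,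
        associator_naturality_left_assoc, ← whisker_exchange_assoc]
      simp
    · rw [hg, ← hg', ← h₅]
      simp

theorem IsLeftKan.isSmall [Small.{w} C] {η : ∀ c, P.obj c ⟶ L.obj (J.obj c)}
    (h : IsLeftKan J P L η) : IsSmall L := by
  refine ⟨Set.range J.obj, inferInstance, fun x y ↦ by simp, fun d X f hf ↦ ?_⟩
  obtain ⟨f', hff⟩ : ∃ f' : ∀ s : Set.range J.obj, L.obj s.1 ⊗ (s.1 ⟶[V] d) ⟶ X, f' = f :=
    ⟨f, rfl⟩
  have hf' : ∀ s s' : Set.range J.obj, L.obj s.1 ◁ eComp V s.1 s'.1 d ≫ f' s =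
      (α_ _ _ _).inv ≫ act L s.1 s'.1 ▷ (s'.1 ⟶[V] d) ≫ f' s' := fun s s' ↦ by
    subst hff
    have h1 := hf s s'
    rw [act_precomp] at h1
    have h2 : L.obj s.1 ◁ (𝟙 (s.1 ⟶[V] s'.1) ▷ (s'.1 ⟶[V] d) ≫ eComp V s.1 s'.1 d) ≫ f' s =
        (α_ _ _ _).inv ≫ (L.obj s.1 ◁ 𝟙 (s.1 ⟶[V] s'.1) ≫ act L s.1 s'.1) ▷ (s'.1 ⟶[V] d) ≫
          f' s' := h1
    simpa using h2
  rw [← hff]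
  obtain ⟨r, hr⟩ : ∃ r : ∀ c, L.obj (J.obj c) ⊗ (J.obj c ⟶[V] d) ⟶ X,
    ∀ c, r c = f' ⟨J.obj c, c, rfl⟩ := ⟨_, fun _ ↦ rfl⟩
  have hf₁ : ∀ (c : C) (s : Set.range J.obj), L.obj (J.obj c) ◁ eComp V (J.obj c) s.1 d ≫ r c =
      (α_ _ _ _).inv ≫ act L (J.obj c) s.1 ▷ (s.1 ⟶[V] d) ≫ f' s := fun c s ↦ by
    rw [hr]
    exact hf' ⟨J.obj c, c, rfl⟩ s
  have hf₂ : ∀ (c c' : C), L.obj (J.obj c) ◁ eComp V (J.obj c) (J.obj c') d ≫ r c =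
      (α_ _ _ _).inv ≫ act L (J.obj c) (J.obj c') ▷ (J.obj c' ⟶[V] d) ≫ r c' := fun c c' ↦ by
    rw [hr c']
    exact hf₁ c ⟨J.obj c', c', rfl⟩
  have e : ∀ (s : Set.range J.obj) (g : L.obj d ⟶ X),
    𝟙 (L.obj s.1) ▷ (s.1 ⟶[V] d) ≫ act L s.1 d ≫ g = act L s.1 d ≫ g := fun s g ↦ by simp
  obtain ⟨g, hg, -⟩ := h.universal d X (fun c ↦ η c ▷ _ ≫ r c) (fun c c' ↦ by
    rw [← comp_whiskerRight_assoc, h.natural' c c', whisker_exchange_assoc]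
    simp only [comp_whiskerRight, MonoidalCategory.whiskerLeft_comp, Category.assoc]
    rw [hf₂]
    simp)
  refine ⟨g, fun s ↦ (e s g).trans (h.hom_ext_right fun c ↦ ?_), fun g' hg' ↦ h.hom_ext fun c ↦ ?_⟩
  · have h1 := hf₁ c s
    rw [Iso.eq_inv_comp] at h1
    rw [← Category.assoc, kan_act]
    simp only [comp_whiskerRight, Category.assoc]
    rw [hg, ← h1, whisker_exchange_assoc]
    simp
  · rw [hg, hr, ← hg' ⟨J.obj c, c, rfl⟩]
    exact congrArg (η c ▷ _ ≫ ·) (e ⟨J.obj c, c, rfl⟩ g').symm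

end Factor

theorem exists_isNatObject_of_small [HasLimitsOfSize.{w, w} V] [Small.{w} C]
    (F G : EnrichedFunctor V C V) : ∃ (E : V) (π : _), IsNatObject F G E π := by
  have h1 : ∀ (α : Type u₁) [Small.{w} α], HasProductsOfShape α V := fun α _ ↦
    hasLimitsOfShape_of_equivalence (Discrete.equivalence (equivShrink.{w} α).symm)
  have := h1 C
  have := h1 (C × C)
  let P := ∏ᶜ fun x : C ↦ (ihom (F.obj x)).obj (G.obj x)
  let p : P ⟶ ∏ᶜ fun p : C × C ↦ (ihom (p.1 ⟶[V] p.2)).obj ((ihom (F.obj p.1)).obj (G.obj p.2)) :=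
    Pi.lift fun p ↦ Pi.π _ p.1 ≫ MonoidalClosed.curry ((β_ _ _).hom ≫
      _ ◁ G.map p.1 p.2 ≫ MonoidalClosed.comp _ _ _)
  let q : P ⟶ ∏ᶜ fun p : C × C ↦ (ihom (p.1 ⟶[V] p.2)).obj ((ihom (F.obj p.1)).obj (G.obj p.2)) :=
    Pi.lift fun p ↦ Pi.π _ p.2 ≫ MonoidalClosed.curry
      (F.map p.1 p.2 ▷ _ ≫ MonoidalClosed.comp _ _ _)
  have key : ∀ {A : V} (a : A ⟶ P), a ≫ p = a ≫ q ↔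
      IsNatFamily F G (fun x ↦ a ≫ Pi.π _ x) := fun {A} a ↦ by
    have : a ≫ p = a ≫ q ↔ ∀ z, a ≫ p ≫ Pi.π _ z = a ≫ q ≫ Pi.π _ z := by
      refine ⟨fun h z ↦ by rw [reassoc_of% h], fun h ↦ Pi.hom_ext _ _ fun z ↦ by simpa using h z⟩
    rw [this, Prod.forall]
    refine forall_congr' fun x ↦ forall_congr' fun y ↦ ?_
    simp only [p, q, limit.lift_π, Fan.mk_pt, Fan.mk_π_app]
    rw [← Category.assoc, ← Category.assoc a, ← MonoidalClosed.curry_natural_left,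
      ← MonoidalClosed.curry_natural_left, MonoidalClosed.curry_injective.eq_iff,
      ← cancel_epi (β_ A (x ⟶[V] y)).hom, eq_comm,
      BraidedCategory.braiding_naturality_right_assoc, SymmetricCategory.symmetry_assoc,
      MonoidalCategory.tensorHom_def', MonoidalCategory.tensorHom_def]
    simp only [Category.assoc]
  refine ⟨equalizer p q, fun x ↦ equalizer.ι p q ≫ Pi.π _ x, (key _).1 (equalizer.condition p q),
    fun A a ha ↦ ⟨equalizer.lift (Pi.lift a) ((key _).2 (by simpa using ha)), fun x ↦ by simp,
      fun f hf ↦ equalizer.hom_ext (Pi.hom_ext _ _ fun x ↦ by simp [hf x])⟩⟩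

theorem exists_isNatObject [HasLimitsOfSize.{w, w} V] {F : EnrichedFunctor V C V} (hF : IsSmall F)
    (G : EnrichedFunctor V C V) : ∃ (E : V) (π : _), IsNatObject F G E π := by
  obtain ⟨S, _, h⟩ := hF
  obtain ⟨E, π, hn, hu⟩ := exists_isNatObject_of_small ((fullSubIncl S).comp V F)
    ((fullSubIncl S).comp V G)
  have hpre : ∀ {x y A : V} (g : A ⟶ (ihom x).obj y),
      g ≫ (MonoidalClosed.pre (𝟙 x)).app y = g := fun g ↦ by simp
  obtain ⟨π', hn', h'⟩ := h.exists_natFamily G hn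
  replace h' : ∀ c : S, π' c.1 = π c := fun c ↦ (hpre _).symm.trans (h' c)
  refine ⟨E, π', hn', fun A a ha ↦ ?_⟩
  obtain ⟨f, hf, huf⟩ := hu A (fun x ↦ a x.1) (ha.precomp (fullSubIncl S))
  refine ⟨f, fun x ↦ ?_, fun g hg ↦ huf g fun x ↦ ?_⟩
  · refine congrFun (h.natFamily_ext (hn'.precomp_hom f) ha fun c ↦ ?_) x
    refine (hpre _).trans (Eq.trans ?_ (hpre _).symm)
    exact (f ≫= h' c).trans (hf c)
  · rw [← h']
    exact hg x.1

theorem comp_assoc₃ {x y z t A B E : V} (f : A ⟶ (ihom x).obj y) (g : B ⟶ (ihom y).obj z)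
    (h : E ⟶ (ihom z).obj t) :
    (f ⊗ₘ ((g ⊗ₘ h) ≫ MonoidalClosed.comp y z t)) ≫ MonoidalClosed.comp x y t =
      (α_ A B E).inv ≫ (((f ⊗ₘ g) ≫ MonoidalClosed.comp x y z) ⊗ₘ h) ≫
        MonoidalClosed.comp x z t := by
  apply MonoidalClosed.uncurry_injective
  rw [uncurry_tensor_comp, uncurry_tensor_comp, MonoidalClosed.uncurry_natural_left,
    uncurry_tensor_comp, uncurry_tensor_comp]
  simp

theorem id_tensor_comp' {x y A : V} (f : A ⟶ (ihom x).obj y) :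
    (MonoidalClosed.id x ⊗ₘ f) ≫ MonoidalClosed.comp x x y = (λ_ A).hom ≫ f := by
  rw [← Iso.inv_comp_eq]
  have h := f ≫= MonoidalClosed.id_comp x y
  rw [leftUnitor_inv_naturality_assoc, whisker_exchange_assoc] at h
  simpa [MonoidalCategory.tensorHom_def] using h

theorem tensor_id_comp' {x y A : V} (f : A ⟶ (ihom x).obj y) :
    (f ⊗ₘ MonoidalClosed.id y) ≫ MonoidalClosed.comp x y y = (ρ_ A).hom ≫ f := by
  rw [← Iso.inv_comp_eq]
  have h := f ≫= MonoidalClosed.comp_id x y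
  rw [rightUnitor_inv_naturality_assoc] at h
  simpa [MonoidalCategory.tensorHom_def] using h

theorem IsNatFamily.id (F : EnrichedFunctor V C V) :
    IsNatFamily F F (fun x ↦ MonoidalClosed.id (F.obj x)) := fun x y ↦ by
  refine (_ ≫= tensor_id_comp' (F.map x y)).trans (Eq.trans ?_ (id_tensor_comp' (F.map x y)).symm)
  simp

theorem IsNatFamily.comp {F G H : EnrichedFunctor V C V} {A B : V}
    {a : ∀ x, A ⟶ (ihom (F.obj x)).obj (G.obj x)} (ha : IsNatFamily F G a)
    {b : ∀ x, B ⟶ (ihom (G.obj x)).obj (H.obj x)} (hb : IsNatFamily G H b) :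
    IsNatFamily F H (fun x ↦ (a x ⊗ₘ b x) ≫ MonoidalClosed.comp _ _ _) := fun x y ↦ by
  have h1 := comp_assoc₃ (F.map x y) (a y) (b y)
  have h2 := comp_assoc₃ (a x) (G.map x y) (b y)
  have h3 := comp_assoc₃ (a x) (b x) (H.map x y)
  have h4 := ha x y
  have h5 := hb x y
  rw [Iso.eq_inv_comp] at h3
  refine Eq.trans ?_ h3
  rw [← h5]
  refine (_ ≫= h1).trans ?_
  rw [BraidedCategory.braiding_tensor_left_hom]
  simp only [Category.assoc, Iso.hom_inv_id_assoc]
  rw [← tensorHom_id (β_ _ _).hom, tensorHom_comp_tensorHom_assoc, Category.id_comp, h4]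
  refine (_ ≫= _ ≫= h2.symm).trans ?_
  rw [← id_tensorHom _ (β_ _ _).hom, tensorHom_comp_tensorHom_assoc, Category.id_comp]

theorem IsNatFamily.postcomp {F G H : EnrichedFunctor V C V} {A : V}
    {a : ∀ x, A ⟶ (ihom (F.obj x)).obj (G.obj x)} (ha : IsNatFamily F G a)
    {θ : ∀ x, G.obj x ⟶ H.obj x} (hθ : IsNatural G H θ) :
    IsNatFamily F H (fun x ↦ a x ≫ (ihom (F.obj x)).map (θ x)) := fun x y ↦ by
  have e : ∀ z, tform F H (fun x ↦ a x ≫ (ihom (F.obj x)).map (θ x)) z = tform F G a z ≫ θ z :=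
    fun z ↦ by rw [tform, MonoidalClosed.uncurry_natural_right, tform, Category.assoc]
  have h1 := (graded_iff F G a x y).1 (ha x y) =≫ θ y
  refine (graded_iff F H (fun x ↦ a x ≫ (ihom (F.obj x)).map (θ x)) x y).2 ?_
  rw [e, e, comp_whiskerRight_assoc, ← hθ x y]
  simpa using h1

theorem id_map_eq_id_pre {x y : V} (h : x ⟶ y) :
    MonoidalClosed.id x ≫ (ihom x).map h =
      MonoidalClosed.id y ≫ (MonoidalClosed.pre h).app y := by
  apply MonoidalClosed.uncurry_injective
  rw [MonoidalClosed.uncurry_natural_right, uncurry_comp_pre, MonoidalClosed.id_eq,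
    MonoidalClosed.id_eq, MonoidalClosed.uncurry_curry, MonoidalClosed.uncurry_curry]
  simp

theorem exists_leftKan [HasColimitsOfSize.{w, w} V] (J : EnrichedFunctor V C D)
    {P : EnrichedFunctor V C V} (hP : IsSmall P) :
    ∃ (L : EnrichedFunctor V D V) (η : _), IsLeftKan J P L η ∧ IsSmall L := by
  obtain ⟨S, _, h⟩ := hP
  obtain ⟨L, η, hL⟩ := exists_leftKan_of_small ((fullSubIncl S).comp V J)
    ((fullSubIncl S).comp V P)
  obtain ⟨η', h'⟩ := h.factor hL
  exact ⟨L, η', h', hL.isSmall⟩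

end Graded

theorem hasLimits_of_locallyPresentable (C : Type u) [Category.{w} C] [IsLocallyPresentable.{w} C] :
    HasLimitsOfSize.{w, w} C := by
  obtain ⟨κ, _, _⟩ := IsLocallyPresentable.exists_cardinal.{w} C
  let P := isCardinalPresentable C κ
  let F : SmallModel.{w} P.FullSubcategory ⥤ C := (equivSmallModel P.FullSubcategory).inverse ⋙ P.ι
  have : F.IsDense := inferInstance
  let R : C ⥤ (SmallModel.{w} P.FullSubcategory)ᵒᵖ ⥤ Type w := Presheaf.restrictedULiftYoneda.{w} F
  have : R.Full := inferInstanceAs (Presheaf.restrictedULiftYoneda.{w} F).Full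
  have : R.Faithful := inferInstanceAs (Presheaf.restrictedULiftYoneda.{w} F).Faithful
  have adj := Presheaf.uliftYonedaAdjunction.{w} _ (uliftYoneda.{w}.leftKanExtensionUnit F)
  let _ : Reflective R := { L := _, adj := adj }
  exact hasLimits_of_reflective R

theorem hasColimits_of_locallyPresentable (C : Type u) [Category.{w} C]
    [IsLocallyPresentable.{w} C] : HasColimitsOfSize.{w, w} C := by
  obtain ⟨κ, _, _⟩ := IsLocallyPresentable.exists_cardinal.{w} C
  infer_instance

section PK

variable (V : Type u) [Category.{w} V] [MonoidalCategory V] [SymmetricCategory V]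
  [MonoidalClosed V]

/-- A small presheaf `Kᵒᵖ ⟶ V`; these are the objects of `P K`. -/
structure SmallPresheaf (K : Type u₁) [EnrichedCategory V K] where
  presheaf : EnrichedFunctor V Kᵒᵖ V
  isSmall : IsSmall presheaf

variable {V} [IsLocallyPresentable.{w} V] {K : Type u₁} [EnrichedCategory V K]

namespace SmallPresheaf

theorem exists_homObj (P Q : SmallPresheaf V K) :
    ∃ (E : V) (π : _), IsNatObject P.presheaf Q.presheaf E π :=
  have := hasLimits_of_locallyPresentable V
  exists_isNatObject P.isSmall Q.presheaf

/-- The hom `∫_k [P k, Q k]` of the `V`-category `P K`. -/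
def homObj (P Q : SmallPresheaf V K) : V := (exists_homObj P Q).choose

/-- The projections of the end `∫_k [P k, Q k]`. -/
def eval (P Q : SmallPresheaf V K) (k : Kᵒᵖ) :
    homObj P Q ⟶ (ihom (P.presheaf.obj k)).obj (Q.presheaf.obj k) :=
  (exists_homObj P Q).choose_spec.choose k

theorem isNatObject (P Q : SmallPresheaf V K) :
    IsNatObject P.presheaf Q.presheaf (homObj P Q) (eval P Q) :=
  (exists_homObj P Q).choose_spec.choose_spec

section lift
variable {P Q : SmallPresheaf V K} {A : V}

/-- The map into the end `∫_k [P k, Q k]` induced by a `V`-natural family. -/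
def lift (a : ∀ k, A ⟶ (ihom (P.presheaf.obj k)).obj (Q.presheaf.obj k))
    (ha : IsNatFamily P.presheaf Q.presheaf a) : A ⟶ homObj P Q :=
  ((isNatObject P Q).universal A a ha).choose

theorem lift_eval (a : ∀ k, A ⟶ (ihom (P.presheaf.obj k)).obj (Q.presheaf.obj k))
    (ha : IsNatFamily P.presheaf Q.presheaf a) (k : Kᵒᵖ) : lift a ha ≫ eval P Q k = a k :=
  ((isNatObject P Q).universal A a ha).choose_spec.1 k

theorem lift_eval_assoc (a : ∀ k, A ⟶ (ihom (P.presheaf.obj k)).obj (Q.presheaf.obj k))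
    (ha : IsNatFamily P.presheaf Q.presheaf a) (k : Kᵒᵖ) {Z : V}
    (h : (ihom (P.presheaf.obj k)).obj (Q.presheaf.obj k) ⟶ Z) :
    lift a ha ≫ eval P Q k ≫ h = a k ≫ h := by
  rw [← Category.assoc, lift_eval]

theorem hom_ext {f g : A ⟶ homObj P Q} (h : ∀ k, f ≫ eval P Q k = g ≫ eval P Q k) : f = g :=
  ((isNatObject P Q).universal A _ ((isNatObject P Q).natural.precomp_hom g)).unique h
    (fun _ ↦ rfl)

end lift

/-- The `V`-category `P K` of small presheaves on `K`. -/
instance : EnrichedCategory V (SmallPresheaf V K) where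
  Hom := homObj
  id P := lift _ (IsNatFamily.id P.presheaf)
  comp P Q R := lift _ ((isNatObject P Q).natural.comp (isNatObject Q R).natural)
  id_comp P Q := hom_ext fun k ↦ by
    have h := (λ_ _).inv ≫= id_tensor_comp' (eval P Q k)
    rw [Iso.inv_hom_id_assoc] at h
    rw [Category.id_comp]
    refine Eq.trans ?_ h
    rw [Category.assoc, Category.assoc, lift_eval, ← tensorHom_id, tensorHom_comp_tensorHom_assoc, lift_eval, Category.id_comp]
  comp_id P Q := hom_ext fun k ↦ by
    have h := (ρ_ _).inv ≫= tensor_id_comp' (eval P Q k)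
    rw [Iso.inv_hom_id_assoc] at h
    rw [Category.id_comp]
    refine Eq.trans ?_ h
    rw [Category.assoc, Category.assoc, lift_eval, ← id_tensorHom, tensorHom_comp_tensorHom_assoc, lift_eval, Category.id_comp]
  assoc P Q R S := hom_ext fun k ↦ by
    simp only [Category.assoc, lift_eval]
    rw [← id_tensorHom, ← tensorHom_id, tensorHom_comp_tensorHom_assoc,
      tensorHom_comp_tensorHom_assoc, lift_eval, lift_eval, Category.id_comp, Category.id_comp,
      comp_assoc₃]

theorem eComp_eval (P Q R : SmallPresheaf V K) (k : Kᵒᵖ) :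
    eComp V P Q R ≫ eval P R k = (eval P Q k ⊗ₘ eval Q R k) ≫ MonoidalClosed.comp _ _ _ :=
  lift_eval _ ((isNatObject P Q).natural.comp (isNatObject Q R).natural) _

theorem eComp_eval_assoc (P Q R : SmallPresheaf V K) (k : Kᵒᵖ) {Z : V}
    (h : (ihom (P.presheaf.obj k)).obj (R.presheaf.obj k) ⟶ Z) :
    eComp V P Q R ≫ eval P R k ≫ h =
      (eval P Q k ⊗ₘ eval Q R k) ≫ MonoidalClosed.comp _ _ _ ≫ h := by
  rw [← Category.assoc, eComp_eval, Category.assoc]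

theorem eId_eval (P : SmallPresheaf V K) (k : Kᵒᵖ) :
    eId V P ≫ eval P P k = MonoidalClosed.id (P.presheaf.obj k) :=
  lift_eval _ (IsNatFamily.id P.presheaf) _

section Lan

variable {L : Type u₂} [EnrichedCategory V L] (F : EnrichedFunctor V K L)

theorem exists_lan (P : SmallPresheaf V K) :
    ∃ (Q : SmallPresheaf V L) (η : _), IsLeftKan (opFunctor F) P.presheaf Q.presheaf η :=
  have := hasColimits_of_locallyPresentable V
  have ⟨L, η, h, hL⟩ := exists_leftKan (opFunctor F) P.isSmall
  ⟨⟨L, hL⟩, η, h⟩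

/-- The value of `P F` at `P`: the left Kan extension of `P` along `Fᵒᵖ`. -/
def lanObj (P : SmallPresheaf V K) : SmallPresheaf V L := (exists_lan F P).choose

/-- The unit `P k ⟶ (P F)(P)(F k)` of the left Kan extension. -/
def lanUnit (P : SmallPresheaf V K) (k : Kᵒᵖ) :
    P.presheaf.obj k ⟶ (lanObj F P).presheaf.obj (op (F.obj k.unop)) :=
  (exists_lan F P).choose_spec.choose k

theorem isLeftKan_lanObj (P : SmallPresheaf V K) :
    IsLeftKan (opFunctor F) P.presheaf (lanObj F P).presheaf (lanUnit F P) :=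
  (exists_lan F P).choose_spec.choose_spec

theorem exists_lanMap (P Q : SmallPresheaf V K) :
    ∃ f : (P ⟶[V] Q) ⟶ (lanObj F P ⟶[V] lanObj F Q), ∀ k : Kᵒᵖ,
      f ≫ eval (lanObj F P) (lanObj F Q) (op (F.obj k.unop)) ≫
          (MonoidalClosed.pre (lanUnit F P k)).app _ =
        eval P Q k ≫ (ihom (P.presheaf.obj k)).map (lanUnit F Q k) := by
  obtain ⟨a, ha, h⟩ := (isLeftKan_lanObj F P).exists_natFamily (lanObj F Q).presheaf
    ((isNatObject P Q).natural.postcomp (isLeftKan_lanObj F Q).natural)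
  refine ⟨lift a ha, fun k ↦ ?_⟩
  rw [lift_eval_assoc]
  exact h k

/-- The action of `P F` on homs, determined by compatibility with the units. -/
def lanMap (P Q : SmallPresheaf V K) : (P ⟶[V] Q) ⟶ (lanObj F P ⟶[V] lanObj F Q) :=
  (exists_lanMap F P Q).choose

theorem lanMap_eval (P Q : SmallPresheaf V K) (k : Kᵒᵖ) :
    lanMap F P Q ≫ eval (lanObj F P) (lanObj F Q) (op (F.obj k.unop)) ≫
        (MonoidalClosed.pre (lanUnit F P k)).app _ =
      eval P Q k ≫ (ihom (P.presheaf.obj k)).map (lanUnit F Q k) :=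
  (exists_lanMap F P Q).choose_spec k

theorem lan_hom_ext {P : SmallPresheaf V K} {Q : SmallPresheaf V L} {A : V}
    {f g : A ⟶ (lanObj F P ⟶[V] Q)}
    (h : ∀ k : Kᵒᵖ, f ≫ eval (lanObj F P) Q (op (F.obj k.unop)) ≫
        (MonoidalClosed.pre (lanUnit F P k)).app _ =
      g ≫ eval (lanObj F P) Q (op (F.obj k.unop)) ≫
        (MonoidalClosed.pre (lanUnit F P k)).app _) : f = g := by
  have hn := (isNatObject (lanObj F P) Q).natural
  refine hom_ext fun k ↦ congrFun ((isLeftKan_lanObj F P).natFamily_ext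
    (hn.precomp_hom f) (hn.precomp_hom g) fun k ↦ ?_) k
  rw [Category.assoc, Category.assoc]
  exact h k

/-- The `V`-functor `P F : P K ⟶ P L` given by left Kan extension along `F`. -/
def lan : EnrichedFunctor V (SmallPresheaf V K) (SmallPresheaf V L) where
  obj := lanObj F
  map := lanMap F
  map_id P := lan_hom_ext F fun k ↦ by
    rw [Category.assoc, lanMap_eval, ← Category.assoc, eId_eval, ← Category.assoc, eId_eval,
      id_map_eq_id_pre]
  map_comp P Q R := lan_hom_ext F fun k ↦ by
    have h1 := tensor_comp_pre (lanUnit F P k)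
      (eval (lanObj F P) (lanObj F Q) (op (F.obj k.unop)))
      (eval (lanObj F Q) (lanObj F R) (op (F.obj k.unop)))
    have h2 := tensor_comp_map (lanUnit F R k) (eval P Q k) (eval Q R k)
    have h3 := tensor_map_pre (lanUnit F Q k) (eval P Q k)
      (lanMap F Q R ≫ eval (lanObj F Q) (lanObj F R) (op (F.obj k.unop)))
    rw [Category.assoc, lanMap_eval, eComp_eval_assoc, ← Category.assoc, h2,
      Category.assoc, eComp_eval_assoc, ← Category.assoc (_ ⊗ₘ _) (MonoidalClosed.comp _ _ _), h1,
      tensorHom_comp_tensorHom_assoc, lanMap_eval, h3, Category.assoc, lanMap_eval]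

end Lan

section Restriction

variable {L : Type u₂} [EnrichedCategory V L] (F : EnrichedFunctor V K L)

/-- The restriction `G Fᵒᵖ` of a presheaf `G` along `F`, when it is small. -/
def restrict (G : SmallPresheaf V L) (hG : IsSmall ((opFunctor F).comp V G.presheaf)) :
    SmallPresheaf V K :=
  ⟨(opFunctor F).comp V G.presheaf, hG⟩

/-- The action `∫_l [G l, G' l] ⟶ ∫_k [G (F k), G' (F k)]` of restriction on homs. -/
def restrictMap (G G' : SmallPresheaf V L) (hG : IsSmall ((opFunctor F).comp V G.presheaf))
    (hG' : IsSmall ((opFunctor F).comp V G'.presheaf)) :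
    (G ⟶[V] G') ⟶ (restrict F G hG ⟶[V] restrict F G' hG') :=
  lift (P := restrict F G hG) (Q := restrict F G' hG') (fun k ↦ eval G G' (op (F.obj k.unop)))
    ((isNatObject G G').natural.precomp (opFunctor F))

theorem restrictMap_eval (G G' : SmallPresheaf V L)
    (hG : IsSmall ((opFunctor F).comp V G.presheaf))
    (hG' : IsSmall ((opFunctor F).comp V G'.presheaf)) (k : Kᵒᵖ) :
    restrictMap F G G' hG hG' ≫ eval (restrict F G hG) (restrict F G' hG') k =
      eval G G' (op (F.obj k.unop)) :=
  lift_eval (P := restrict F G hG) (Q := restrict F G' hG') _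
    ((isNatObject G G').natural.precomp (opFunctor F)) k

/-- Restriction along `F` as a `V`-functor `P L ⟶ P K`, when all restrictions are small. -/
def restriction (h : ∀ G : SmallPresheaf V L, IsSmall ((opFunctor F).comp V G.presheaf)) :
    EnrichedFunctor V (SmallPresheaf V L) (SmallPresheaf V K) where
  obj G := restrict F G (h G)
  map G G' := restrictMap F G G' (h G) (h G')
  map_id G := hom_ext fun k ↦ by
    rw [Category.assoc]
    exact (_ ≫= restrictMap_eval F G G (h G) (h G) k).trans
      ((eId_eval G (op (F.obj k.unop))).trans (eId_eval (restrict F G (h G)) k).symm)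
  map_comp G G' G'' := hom_ext fun k ↦ by
    rw [Category.assoc, Category.assoc, eComp_eval, tensorHom_comp_tensorHom_assoc]
    refine (_ ≫= restrictMap_eval F G G'' (h G) (h G'') k).trans
      ((eComp_eval G G' G'' (op (F.obj k.unop))).trans ?_)
    exact congrArg₂ (fun f g ↦ (f ⊗ₘ g) ≫ MonoidalClosed.comp _ _ _)
      (restrictMap_eval F G G' (h G) (h G') k).symm (restrictMap_eval F G' G'' (h G') (h G'') k).symm

end Restriction

end SmallPresheaf
end PK


section Adjunction

variable (V : Type u) [Category.{w} V] [MonoidalCategory V]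
  {A : Type u₁} [EnrichedCategory V A] {B : Type u₂} [EnrichedCategory V B]

variable {V} in
/-- An adjunction of `V`-functors: isomorphisms `B(T a, b) ≅ A(a, R b)` in `V`, `V`-natural in
`a` and in `b`. -/
structure VAdjunction (T : EnrichedFunctor V A B) (R : EnrichedFunctor V B A) where
  homIso (a : A) (b : B) : (T.obj a ⟶[V] b) ≅ (a ⟶[V] R.obj b)
  natural_left (a a' : A) (b : B) :
    T.map a a' ▷ (T.obj a' ⟶[V] b) ≫ eComp V (T.obj a) (T.obj a') b ≫ (homIso a b).hom =
      (a ⟶[V] a') ◁ (homIso a' b).hom ≫ eComp V a a' (R.obj b)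
  natural_right (a : A) (b b' : B) :
    eComp V (T.obj a) b b' ≫ (homIso a b').hom =
      ((homIso a b).hom ⊗ₘ R.map b b') ≫ eComp V a (R.obj b) (R.obj b')

variable {V} in
/-- A `V`-natural isomorphism between `V`-functors: mutually inverse elements
`hom x : 1 ⟶ B(F x, G x)` and `inv x : 1 ⟶ B(G x, F x)`, `V`-natural in `x`. -/
structure VNatIso (F G : EnrichedFunctor V A B) where
  hom (x : A) : 𝟙_ V ⟶ (F.obj x ⟶[V] G.obj x)
  inv (x : A) : 𝟙_ V ⟶ (G.obj x ⟶[V] F.obj x)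
  hom_inv (x : A) :
    (λ_ (𝟙_ V)).inv ≫ (hom x ⊗ₘ inv x) ≫ eComp V (F.obj x) (G.obj x) (F.obj x) = eId V (F.obj x)
  inv_hom (x : A) :
    (λ_ (𝟙_ V)).inv ≫ (inv x ⊗ₘ hom x) ≫ eComp V (G.obj x) (F.obj x) (G.obj x) = eId V (G.obj x)
  natural (x y : A) :
    (λ_ (x ⟶[V] y)).inv ≫ (hom x ⊗ₘ G.map x y) ≫ eComp V (F.obj x) (G.obj x) (G.obj y) =
      (ρ_ (x ⟶[V] y)).inv ≫ (F.map x y ⊗ₘ hom y) ≫ eComp V (F.obj x) (F.obj y) (G.obj y)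

end Adjunction
end EnrichedPresheaf
end

open EnrichedPresheaf

/-!
Let `F : K ⟶ L` be a `V`-functor. For a small presheaf `P` on `K` and any presheaf `G` on `L`, the
universal property of left Kan extension says that `V`-natural transformations `PF(P) ⟶ G` are the
same as `V`-natural transformations `P ⟶ G Fᵒᵖ` (`SmallPresheaf.isNatObject_lan`). Restriction along
`F` is therefore right adjoint to `PF` as soon as it preserves smallness
(`SmallPresheaf.nonempty_lan_adjunction`), and what remains is a question of smallness.

If every `L(F-, l)` is small, restriction preserves smallness (`IsSmall.precomp`): a small presheaf
`G` is a coend `∫^{s ∈ S} G s ⊗ L(-, s)` with `S` small, so `G Fᵒᵖ` is the coend over `s` of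
`G s ⊗ L(F-, s)`. Each `L(F-, s)` is a coend over a small set `T s`, all of them are coends over the
small set `⋃ s, T s`, and coends commute with coends and with tensor products.

Conversely, suppose that `PF` has a right adjoint `R`. The transpose of the counit at `G` is a
`V`-natural transformation `θ : R G ⟶ G Fᵒᵖ`, and composition with `θ` is the bijection between
transformations `P ⟶ R G`, transformations `PF(P) ⟶ G` and transformations `P ⟶ G Fᵒᵖ`. With `P`
representable, which is small, the `V`-Yoneda lemma shows that `θ` is invertible. So every `G Fᵒᵖ`
is small (`SmallPresheaf.isSmall_comp_of_adjunction`), in particular for `G` representable.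
Restriction is then another right adjoint of `PF`, and right adjoints of `V`-functors are unique up
to `V`-natural isomorphism (`VAdjunction.rightAdjointUniq`).
-/

namespace EnrichedPresheaf

/-! ### Uniqueness of right adjoints of `V`-functors -/

section Adjoint

variable {V : Type u} [Category.{w} V] [MonoidalCategory V]
  {A : Type u₁} [EnrichedCategory V A] {B : Type u₂} [EnrichedCategory V B]
  {T : EnrichedFunctor V A B} {R R' : EnrichedFunctor V B A}

namespace VAdjunction

/-- The counit of a `V`-adjunction at `b`, as an element of `B(T (R b), b)`. -/
def counit (adj : VAdjunction T R) (b : B) : 𝟙_ V ⟶ (T.obj (R.obj b) ⟶[V] b) :=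
  eId V (R.obj b) ≫ (adj.homIso (R.obj b) b).inv

theorem counit_homIso (adj : VAdjunction T R) (b : B) :
    adj.counit b ≫ (adj.homIso (R.obj b) b).hom = eId V (R.obj b) := by
  simp [counit]

/-- The inverse of the adjunction isomorphism applies `T` and composes with the counit. -/
theorem homIso_inv (adj : VAdjunction T R) (a : A) (b : B) :
    (adj.homIso a b).inv = (ρ_ _).inv ≫ (T.map a (R.obj b) ⊗ₘ adj.counit b) ≫
      eComp V (T.obj a) (T.obj (R.obj b)) b := by
  rw [← cancel_mono (adj.homIso a b).hom, Iso.inv_hom_id, Category.assoc, Category.assoc,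
    MonoidalCategory.tensorHom_def', Category.assoc, adj.natural_left,
    ← MonoidalCategory.whiskerLeft_comp_assoc, counit_homIso, e_comp_id]

/-- The comparison `A(a, R b) ≅ B(T a, b) ≅ A(a, R' b)` is composition with the image of the
counit. -/
theorem homIso_inv_hom (adj : VAdjunction T R) (adj' : VAdjunction T R') (a : A) (b : B) :
    (adj.homIso a b).inv ≫ (adj'.homIso a b).hom =
      (ρ_ _).inv ≫ _ ◁ (adj.counit b ≫ (adj'.homIso (R.obj b) b).hom) ≫
        eComp V a (R.obj b) (R'.obj b) := by
  rw [homIso_inv, MonoidalCategory.tensorHom_def', Category.assoc, Category.assoc, Category.assoc,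
    adj'.natural_left, MonoidalCategory.whiskerLeft_comp_assoc]

/-- `V`-naturality of the counit. -/
theorem counit_comp (adj : VAdjunction T R) (b b' : B) :
    (λ_ _).inv ≫ adj.counit b ▷ (b ⟶[V] b') ≫ eComp V (T.obj (R.obj b)) b b' =
      R.map b b' ≫ (adj.homIso (R.obj b) b').inv := by
  rw [Iso.eq_comp_inv, Category.assoc, Category.assoc, adj.natural_right,
    MonoidalCategory.tensorHom_def, Category.assoc, ← comp_whiskerRight_assoc, counit_homIso,
    ← whisker_exchange_assoc, ← leftUnitor_inv_naturality_assoc, e_id_comp, Category.comp_id]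

/-- The image of the counit of one adjunction under the isomorphism of another one. -/
def comparison (adj : VAdjunction T R) (adj' : VAdjunction T R') (b : B) :
    𝟙_ V ⟶ (R.obj b ⟶[V] R'.obj b) :=
  adj.counit b ≫ (adj'.homIso (R.obj b) b).hom

theorem comparison_comp_comparison (adj : VAdjunction T R) (adj' : VAdjunction T R') (b : B) :
    (λ_ (𝟙_ V)).inv ≫ (comparison adj adj' b ⊗ₘ comparison adj' adj b) ≫
      eComp V (R.obj b) (R'.obj b) (R.obj b) = eId V (R.obj b) := by
  have h := comparison adj adj' b ≫= homIso_inv_hom adj' adj (R.obj b) b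
  rw [rightUnitor_inv_naturality_assoc, ← tensorHom_def_assoc, ← unitors_inv_equal] at h
  refine h.symm.trans ?_
  rw [comparison, Category.assoc, Iso.hom_inv_id_assoc, counit_homIso]

/-- Right adjoints of a `V`-functor are unique up to `V`-natural isomorphism. -/
def rightAdjointUniq (adj : VAdjunction T R) (adj' : VAdjunction T R') : VNatIso R R' where
  hom := comparison adj adj'
  inv := comparison adj' adj
  hom_inv := comparison_comp_comparison adj adj'
  inv_hom := comparison_comp_comparison adj' adj
  natural x y := by
    have h := R.map x y ≫= homIso_inv_hom adj adj' (R.obj x) y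
    rw [rightUnitor_inv_naturality_assoc, ← tensorHom_def_assoc] at h
    refine Eq.trans ?_ h
    rw [← Category.assoc (R.map x y), ← counit_comp, Category.assoc, Category.assoc,
      adj'.natural_right, MonoidalCategory.tensorHom_def_assoc, MonoidalCategory.tensorHom_def_assoc,
      comparison, comp_whiskerRight_assoc]

end VAdjunction
end Adjoint

/-! ### Generation by a set of objects -/

section Generated

variable {V : Type u} [Category.{w} V] [MonoidalCategory V] [MonoidalClosed V]
  {C : Type u₁} [EnrichedCategory V C] {D : Type u₂} [EnrichedCategory V D]

/-- `H : C ⟶ V` is generated by the set `S` of objects if the actions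
`H s ⊗ C(s, d) ⟶ H d` exhibit each `H d` as the coend `∫^{s ∈ S} H s ⊗ C(s, d)`. -/
def IsGeneratedBy (S : Set C) (H : EnrichedFunctor V C V) : Prop :=
  ∀ (d : C) (X : V) (f : ∀ s ∈ S, H.obj s ⊗ (s ⟶[V] d) ⟶ X),
    (∀ s hs s' hs', H.obj s ◁ eComp V s s' d ≫ f s hs =
      (α_ _ _ _).inv ≫ act H s s' ▷ (s' ⟶[V] d) ≫ f s' hs') →
    ∃! g : H.obj d ⟶ X, ∀ s hs, act H s d ≫ g = f s hs

theorem isLeftKan_fullSubIncl_iff (S : Set C) (H : EnrichedFunctor V C V) :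
    IsLeftKan (fullSubIncl S) ((fullSubIncl S).comp V H) H (fun _ ↦ 𝟙 _) ↔
      IsGeneratedBy S H := by
  have hact : ∀ s s' : S, act ((fullSubIncl S).comp V H) s s' = act H s.1 s'.1 := fun s s' ↦ by
    rw [act_precomp]
    exact (congrArg (· ≫ act H s.1 s'.1) (MonoidalCategory.whiskerLeft_id _ _)).trans
      (Category.id_comp _)
  have hco : ∀ (d : C) (X : V) (f : ∀ s : S, H.obj s.1 ⊗ (s.1 ⟶[V] d) ⟶ X),
      IsCowedge (fullSubIncl S) ((fullSubIncl S).comp V H) d f ↔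
        ∀ s s' : S, H.obj s.1 ◁ eComp V s.1 s'.1 d ≫ f s =
          (α_ _ _ _).inv ≫ act H s.1 s'.1 ▷ (s'.1 ⟶[V] d) ≫ f s' := fun d X f ↦ by
    refine forall_congr' fun s ↦ forall_congr' fun s' ↦ ?_
    rw [hact]
    have h : 𝟙 (s.1 ⟶[V] s'.1) ▷ (s'.1 ⟶[V] d) ≫ eComp V s.1 s'.1 d = eComp V s.1 s'.1 d := by
      simp
    exact Eq.congr_left (congrArg (fun z ↦ H.obj s.1 ◁ z ≫ f s) h)
  have hun : ∀ (d : C) (X : V) (s : S) (g : H.obj d ⟶ X),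
      𝟙 (H.obj s.1) ▷ (s.1 ⟶[V] d) ≫ act H s.1 d ≫ g = act H s.1 d ≫ g := fun d X s g ↦ by simp
  constructor
  · intro h d X f hf
    obtain ⟨g, hg, hu⟩ := h.universal d X (fun s ↦ f s.1 s.2)
      ((hco d X _).2 fun s s' ↦ hf s.1 s.2 s'.1 s'.2)
    exact ⟨g, fun s hs ↦ (hun d X ⟨s, hs⟩ g).symm.trans (hg ⟨s, hs⟩),
      fun g' hg' ↦ hu g' fun s ↦ (hun d X s g').trans (hg' s.1 s.2)⟩
  · intro h
    refine ⟨fun s s' ↦ by simp, fun d X f hf ↦ ?_⟩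
    obtain ⟨g, hg, hu⟩ := h d X (fun s hs ↦ f ⟨s, hs⟩)
      (fun s hs s' hs' ↦ (hco d X f).1 hf ⟨s, hs⟩ ⟨s', hs'⟩)
    exact ⟨g, fun s ↦ (hun d X s g).trans (hg s.1 s.2),
      fun g' hg' ↦ hu g' fun s hs ↦ (hun d X ⟨s, hs⟩ g').symm.trans (hg' ⟨s, hs⟩)⟩

theorem isSmall_iff (H : EnrichedFunctor V C V) :
    IsSmall H ↔ ∃ S : Set C, Small.{w} S ∧ IsGeneratedBy S H :=
  exists_congr fun S ↦ and_congr_right fun _ ↦ isLeftKan_fullSubIncl_iff S H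

theorem act_whiskerRight_act (H : EnrichedFunctor V C V) (x y z : C) :
    act H x y ▷ (y ⟶[V] z) ≫ act H y z =
      (α_ _ _ _).hom ≫ H.obj x ◁ eComp V x y z ≫ act H x z := by
  rw [act_comp, Iso.hom_inv_id_assoc]

namespace IsGeneratedBy

variable {S : Set C} {H : EnrichedFunctor V C V}

theorem hom_ext (h : IsGeneratedBy S H) {d : C} {X : V} {g g' : H.obj d ⟶ X}
    (w : ∀ s ∈ S, act H s d ≫ g = act H s d ≫ g') : g = g' := by
  refine (h d X (fun s _ ↦ act H s d ≫ g') fun s _ s' _ ↦ ?_).unique w fun _ _ ↦ rfl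
  rw [← Category.assoc, act_comp]
  simp

theorem hom_ext_left (h : IsGeneratedBy S H) {d : C} {A X : V} {g g' : A ⊗ H.obj d ⟶ X}
    (w : ∀ s ∈ S, A ◁ act H s d ≫ g = A ◁ act H s d ≫ g') : g = g' := by
  apply MonoidalClosed.curry_injective
  refine h.hom_ext fun s hs ↦ ?_
  rw [← MonoidalClosed.curry_natural_left, w s hs, MonoidalClosed.curry_natural_left]

theorem hom_ext_right [BraidedCategory V] (h : IsGeneratedBy S H) {d : C} {A X : V}
    {g g' : H.obj d ⊗ A ⟶ X}
    (w : ∀ s ∈ S, act H s d ▷ A ≫ g = act H s d ▷ A ≫ g') : g = g' := by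
  rw [← cancel_epi (β_ A (H.obj d)).hom]
  refine h.hom_ext_left fun s hs ↦ ?_
  rw [BraidedCategory.braiding_naturality_right_assoc,
    BraidedCategory.braiding_naturality_right_assoc, w s hs]

/-- A generating set may be enlarged. -/
theorem mono [BraidedCategory V] {S' : Set C} (h : IsGeneratedBy S H) (hS : S ⊆ S') :
    IsGeneratedBy S' H := fun d X f hf ↦ by
  obtain ⟨g, hg, hu⟩ := h d X (fun s hs ↦ f s (hS hs))
    (fun s hs s' hs' ↦ hf s (hS hs) s' (hS hs'))
  refine ⟨g, fun t ht ↦ h.hom_ext_right fun s hs ↦ ?_, fun g' hg' ↦ hu g' fun s hs ↦ hg' s (hS hs)⟩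
  rw [← Category.assoc, act_whiskerRight_act, Category.assoc, Category.assoc, hg s hs,
    hf s (hS hs) t ht, Iso.hom_inv_id_assoc]

/-- Generation is invariant under `V`-natural isomorphism. -/
theorem of_iso {H' : EnrichedFunctor V C V} (h : IsGeneratedBy S H) (θ : ∀ x, H.obj x ≅ H'.obj x)
    (hθ : IsNatural H H' (fun x ↦ (θ x).hom)) : IsGeneratedBy S H' := fun d X f hf ↦ by
  obtain ⟨g, hg, hu⟩ := h d X (fun s hs ↦ (θ s).hom ▷ _ ≫ f s hs) (fun s hs s' hs' ↦ by
    rw [whisker_exchange_assoc, hf s hs s' hs', ← comp_whiskerRight_assoc, hθ s s']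
    simp)
  refine ⟨(θ d).inv ≫ g, fun s hs ↦ ?_, fun g' hg' ↦ ?_⟩
  · rw [← cancel_epi ((θ s).hom ▷ (s ⟶[V] d)), ← hg s hs, ← Category.assoc, ← hθ s d]
    simp
  · rw [Iso.eq_inv_comp]
    refine hu _ fun s hs ↦ ?_
    rw [← Category.assoc, hθ s d, Category.assoc, hg' s hs]

end IsGeneratedBy

theorem act_representable (c x y : C) :
    act (representable (V := V) c) x y = eComp V c x y :=
  act_ofAct _ _ _ _ _ _

/-- Representables are generated by the representing object, by the co-Yoneda lemma. -/
theorem isGeneratedBy_representable (c : C) :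
    IsGeneratedBy {c} (representable (V := V) c) := fun d X f hf ↦ by
  obtain ⟨r, hr⟩ : ∃ r : (c ⟶[V] c) ⊗ (c ⟶[V] d) ⟶ X, f c rfl = r := ⟨_, rfl⟩
  have hr' : (c ⟶[V] c) ◁ eComp V c c d ≫ r = (α_ _ _ _).inv ≫ eComp V c c c ▷ _ ≫ r := by
    have h := hf c rfl c rfl
    rw [act_representable, hr] at h
    exact h
  refine ⟨(λ_ (c ⟶[V] d)).inv ≫ eId V c ▷ (c ⟶[V] d) ≫ r, ?_, fun g hg ↦ ?_⟩
  · rintro s rfl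
    rw [act_representable, hr]
    refine (leftUnitor_inv_naturality_assoc (eComp V s s d) (eId V s ▷ _ ≫ r)).trans ?_
    rw [whisker_exchange_assoc, hr', associator_inv_naturality_left_assoc,
      ← comp_whiskerRight_assoc (eId V s ▷ (s ⟶[V] s))]
    have h := congrArg (· ▷ (s ⟶[V] d)) (e_id_comp V s s)
    simp only [comp_whiskerRight, id_whiskerRight] at h
    simpa using h =≫ r
  · obtain ⟨g, rfl⟩ : ∃ g' : (c ⟶[V] d) ⟶ X, g' = g := ⟨g, rfl⟩
    have h := hg c rfl
    rw [act_representable, hr] at h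
    rw [← h]
    exact (e_id_comp_assoc V c d g).symm

theorem act_comp_representable (J : EnrichedFunctor V C D) (s : D) (x y : C) :
    act (J.comp V (representable s)) x y =
      (s ⟶[V] J.obj x) ◁ J.map x y ≫ eComp V s (J.obj x) (J.obj y) := by
  rw [act_precomp, act_representable]
  rfl

theorem isSmall_representable (c : C) : IsSmall (representable (V := V) c) :=
  (isSmall_iff _).2 ⟨{c}, inferInstance, isGeneratedBy_representable c⟩

theorem IsSmall.of_iso {H H' : EnrichedFunctor V C V} (h : IsSmall H) (θ : ∀ x, H.obj x ≅ H'.obj x)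
    (hθ : IsNatural H H' (fun x ↦ (θ x).hom)) : IsSmall H' := by
  rw [isSmall_iff] at h ⊢
  obtain ⟨S, hS, h⟩ := h
  exact ⟨S, hS, h.of_iso θ hθ⟩

end Generated

section Restrict

variable {V : Type u} [Category.{w} V] [MonoidalCategory V] [SymmetricCategory V]
  [MonoidalClosed V]
  {C : Type u₁} [EnrichedCategory V C] {D : Type u₂} [EnrichedCategory V D]

/-- If `G` is generated by `S` and each `D(s, J -)` with `s ∈ S` is generated by `T`, then `G J` is
generated by `T`: `G (J c)` is the coend over `s` of `G s ⊗ D(s, J c)`, and coends commute with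
coends and with tensor products. -/
theorem IsGeneratedBy.precomp {J : EnrichedFunctor V C D} {G : EnrichedFunctor V D V} {S : Set D}
    {T : Set C} (hG : IsGeneratedBy S G)
    (hJ : ∀ s ∈ S, IsGeneratedBy T (J.comp V (representable s))) :
    IsGeneratedBy T (J.comp V G) := fun d X f hf ↦ by
  -- The action of `D(s, J -)`, stated without the composite functor `J.comp V (representable s)`.
  obtain ⟨m, hm⟩ : ∃ m : ∀ (s : D) (t : C), (s ⟶[V] J.obj t) ⊗ (t ⟶[V] d) ⟶ (s ⟶[V] J.obj d),
      ∀ s t, m s t = (s ⟶[V] J.obj t) ◁ J.map t d ≫ eComp V s (J.obj t) (J.obj d) :=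
    ⟨_, fun _ _ ↦ rfl⟩
  obtain ⟨f, rfl⟩ : ∃ f' : ∀ t ∈ T, G.obj (J.obj t) ⊗ (t ⟶[V] d) ⟶ X, f' = f := ⟨f, rfl⟩
  have hf' : ∀ t ht t' ht', G.obj (J.obj t) ◁ eComp V t t' d ≫ f t ht = (α_ _ _ _).inv ≫
      (G.obj (J.obj t) ◁ J.map t t' ≫ act G (J.obj t) (J.obj t')) ▷ (t' ⟶[V] d) ≫ f t' ht' := by
    intro t ht t' ht'
    rw [← act_precomp]
    exact hf t ht t' ht'
  have hact : ∀ s t, act (J.comp V (representable s)) t d = m s t := fun s t ↦ by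
    rw [act_comp_representable, hm]
  have ext : ∀ s ∈ S, ∀ {A Y : V} {g g' : A ⊗ (s ⟶[V] J.obj d) ⟶ Y},
      (∀ t ∈ T, A ◁ m s t ≫ g = A ◁ m s t ≫ g') → g = g' := fun s hs A Y g g' w ↦
    (hJ s hs).hom_ext_left (d := d) fun t ht ↦ by
      rw [hact]
      exact w t ht
  have desc : ∀ s ∈ S, ∀ (Y : V) (f : ∀ t ∈ T, (s ⟶[V] J.obj t) ⊗ (t ⟶[V] d) ⟶ Y),
      (∀ t ht t' ht', (s ⟶[V] J.obj t) ◁ eComp V t t' d ≫ f t ht = (α_ _ _ _).inv ≫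
        ((s ⟶[V] J.obj t) ◁ J.map t t' ≫ eComp V s (J.obj t) (J.obj t')) ▷ (t' ⟶[V] d) ≫
          f t' ht') →
      ∃ g : (s ⟶[V] J.obj d) ⟶ Y, ∀ t ht, m s t ≫ g = f t ht := fun s hs Y f hf ↦ by
    obtain ⟨g, hg, -⟩ := hJ s hs d Y f (fun t ht t' ht' ↦ by
      rw [act_comp_representable]
      exact hf t ht t' ht')
    refine ⟨g, fun t ht ↦ ?_⟩
    rw [← hact]
    exact hg t ht
  -- For fixed `s`, descend along the coend over `t` which computes `D(s, J d)`.
  have exu : ∀ s ∈ S, ∃ u : G.obj s ⊗ (s ⟶[V] J.obj d) ⟶ X, ∀ t ht,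
      G.obj s ◁ m s t ≫ u = (α_ _ _ _).inv ≫ act G s (J.obj t) ▷ (t ⟶[V] d) ≫ f t ht := by
    intro s hs
    obtain ⟨g, hg⟩ := desc s hs ((ihom (G.obj s)).obj X)
      (fun t ht ↦ MonoidalClosed.curry ((α_ _ _ _).inv ≫ act G s (J.obj t) ▷ (t ⟶[V] d) ≫ f t ht))
      (fun t ht t' ht' ↦ by
        rw [← MonoidalClosed.curry_natural_left, ← MonoidalClosed.curry_natural_left,
          ← MonoidalClosed.curry_natural_left]
        apply congrArg (MonoidalClosed.curry (A := G.obj s))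
        rw [associator_inv_naturality_right_assoc, whisker_exchange_assoc, hf' t ht t' ht',
          associator_inv_naturality_middle_assoc, ← comp_whiskerRight_assoc,
          MonoidalCategory.whiskerLeft_comp, Category.assoc, act_comp,
          associator_inv_naturality_right_assoc, whisker_exchange_assoc]
        simp)
    refine ⟨MonoidalClosed.uncurry g, fun t ht ↦ ?_⟩
    rw [← MonoidalClosed.uncurry_natural_left, hg, MonoidalClosed.uncurry_curry]
  choose u hu using exu
  have hm_assoc : ∀ (s s' : D) (t : C), (s ⟶[V] s') ◁ m s' t ≫ eComp V s s' (J.obj d) =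
      (α_ _ _ _).inv ≫ eComp V s s' (J.obj t) ▷ _ ≫ m s t := fun s s' t ↦ by
    rw [hm, hm, ← whisker_exchange_assoc, ← associator_inv_naturality_right_assoc, e_assoc,
      MonoidalCategory.whiskerLeft_comp_assoc]
  -- The maps `u s` form a cowedge in `s`, so they descend along the coend computing `G (J d)`.
  obtain ⟨g, hg, hgu⟩ := hG (J.obj d) X u (fun s hs s' hs' ↦ by
    rw [← cancel_epi (α_ _ _ _).hom, Iso.hom_inv_id_assoc]
    refine ext s' hs' fun t ht ↦ ?_
    rw [whisker_exchange_assoc, hu s' hs' t ht, associator_naturality_right_assoc,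
      ← MonoidalCategory.whiskerLeft_comp_assoc, hm_assoc, MonoidalCategory.whiskerLeft_comp,
      MonoidalCategory.whiskerLeft_comp, Category.assoc, Category.assoc, hu s hs t ht,
      associator_inv_naturality_middle_assoc, ← comp_whiskerRight_assoc (_ ◁ _), act_comp]
    simp)
  have hmg : ∀ s t, act G s (J.obj t) ▷ (t ⟶[V] d) ≫ G.obj (J.obj t) ◁ J.map t d ≫
      act G (J.obj t) (J.obj d) = (α_ _ _ _).hom ≫ G.obj s ◁ m s t ≫ act G s (J.obj d) :=
    fun s t ↦ by
      rw [← whisker_exchange_assoc, act_whiskerRight_act, hm]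
      simp
  -- Both conditions on `g` amount to the same condition on the objects
  -- `G s ⊗ D(s, J t) ⊗ C(t, d)`, which cover `G (J d)`.
  have key : ∀ g : G.obj (J.obj d) ⟶ X,
      (∀ t ht, act (J.comp V G) t d ≫ g = f t ht) ↔ ∀ s hs, act G s (J.obj d) ≫ g = u s hs := by
    intro g
    have h : (∀ t ht, act (J.comp V G) t d ≫ g = f t ht) ↔
        ∀ t ht, G.obj (J.obj t) ◁ J.map t d ≫ act G (J.obj t) (J.obj d) ≫ g = f t ht := by
      refine forall_congr' fun t ↦ forall_congr' fun ht ↦ Eq.congr_left ?_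
      rw [act_precomp]
      exact Category.assoc _ _ _
    rw [h]
    refine ⟨fun hg s hs ↦ ext s hs fun t ht ↦ ?_, fun hg t ht ↦ hG.hom_ext_right fun s hs ↦ ?_⟩
    · rw [hu s hs t ht, ← hg, Iso.eq_inv_comp]
      simpa using (hmg s t =≫ g).symm
    · have h := hmg s t =≫ g
      simp only [Category.assoc] at h
      rw [h, hg s hs, hu s hs t ht, Iso.hom_inv_id_assoc]
  exact ⟨g, (key g).2 hg, fun g' hg' ↦ hgu g' ((key g').1 hg')⟩

/-- If all `D(d, J -)` are small, then restriction along `J` preserves smallness. -/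
theorem IsSmall.precomp {J : EnrichedFunctor V C D}
    (hJ : ∀ d, IsSmall (J.comp V (representable d))) {G : EnrichedFunctor V D V} (hG : IsSmall G) :
    IsSmall (J.comp V G) := by
  simp only [isSmall_iff] at hJ hG ⊢
  obtain ⟨S, _, hG⟩ := hG
  choose T hT hJ using hJ
  exact ⟨⋃ s : S, T s, inferInstance,
    hG.precomp fun s hs ↦ (hJ s).mono (Set.subset_iUnion (fun s : S ↦ T s) ⟨s, hs⟩)⟩

end Restrict

/-! ### Objects of `V`-natural transformations -/

section NatObject

variable {V : Type u} [Category.{w} V] [MonoidalCategory V] [SymmetricCategory V]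
  [MonoidalClosed V] {C : Type u₁} [EnrichedCategory V C] {D : Type u₂} [EnrichedCategory V D]

theorem IsNatFamily.precomp_nat {F G H : EnrichedFunctor V C V} {A : V}
    {a : ∀ x, A ⟶ (ihom (G.obj x)).obj (H.obj x)} (ha : IsNatFamily G H a)
    {θ : ∀ x, F.obj x ⟶ G.obj x} (hθ : IsNatural F G θ) :
    IsNatFamily F H (fun x ↦ a x ≫ (MonoidalClosed.pre (θ x)).app (H.obj x)) := fun x y ↦ by
  have e : ∀ z, tform F H (fun x ↦ a x ≫ (MonoidalClosed.pre (θ x)).app (H.obj x)) z =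
      A ◁ θ z ≫ tform G H a z := fun z ↦ by
    rw [tform, uncurry_comp_pre, tform, BraidedCategory.braiding_naturality_right_assoc]
  have h1 := (graded_iff G H a x y).1 (ha x y)
  refine (graded_iff F H (fun x ↦ a x ≫ (MonoidalClosed.pre (θ x)).app (H.obj x)) x y).2 ?_
  rw [e, e, ← MonoidalCategory.whiskerLeft_comp_assoc, hθ x y, MonoidalCategory.whiskerLeft_comp,
    Category.assoc, ← h1]
  simp

/-- A `V`-natural family of elements `1 ⟶ [F x, G x]` is a `V`-natural family of maps
`F x ⟶ G x`. -/
theorem IsNatFamily.isNatural {F G : EnrichedFunctor V C V}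
    {a : ∀ x, 𝟙_ V ⟶ (ihom (F.obj x)).obj (G.obj x)} (ha : IsNatFamily F G a) :
    IsNatural F G (fun x ↦ (ρ_ (F.obj x)).inv ≫ MonoidalClosed.uncurry (a x)) := fun x y ↦ by
  have e : ∀ z, (ρ_ (F.obj z)).inv ≫ MonoidalClosed.uncurry (a z) =
      (λ_ (F.obj z)).inv ≫ tform F G a z := fun z ↦ by
    rw [tform, ← Category.assoc, leftUnitor_inv_braiding]
  have h1 := (graded_iff F G a x y).1 (ha x y)
  simp only [e]
  rw [leftUnitor_inv_naturality_assoc, ← h1]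
  simp

omit [SymmetricCategory V] in
/-- Composition with an element of `[y, z]` is composition with the corresponding map `y ⟶ z`. -/
theorem comp_element {x y z A : V} (f : A ⟶ (ihom x).obj y) (a : 𝟙_ V ⟶ (ihom y).obj z) :
    (ρ_ A).inv ≫ (f ⊗ₘ a) ≫ MonoidalClosed.comp x y z =
      f ≫ (ihom x).map ((ρ_ y).inv ≫ MonoidalClosed.uncurry a) := by
  apply MonoidalClosed.uncurry_injective
  rw [MonoidalClosed.uncurry_natural_left, uncurry_tensor_comp, MonoidalClosed.uncurry_natural_right]
  simp

/-- The `V`-natural family `H c ⟶ [C(c, x), H x]` given by the action of `H`. -/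
def yonedaFamily (c : C) (H : EnrichedFunctor V C V) (x : C) :
    H.obj c ⟶ (ihom (c ⟶[V] x)).obj (H.obj x) :=
  MonoidalClosed.curry ((β_ _ _).hom ≫ act H c x)

theorem comp_yonedaFamily {c : C} {H : EnrichedFunctor V C V} {A : V} (f : A ⟶ H.obj c) (x : C) :
    f ≫ yonedaFamily c H x =
      MonoidalClosed.curry ((β_ _ _).hom ≫ f ▷ (c ⟶[V] x) ≫ act H c x) := by
  rw [yonedaFamily, ← MonoidalClosed.curry_natural_left,
    BraidedCategory.braiding_naturality_right_assoc]

theorem yonedaFamily_map {c : C} {H H' : EnrichedFunctor V C V} {θ : ∀ x, H.obj x ⟶ H'.obj x}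
    (hθ : IsNatural H H' θ) (x : C) :
    yonedaFamily c H x ≫ (ihom (c ⟶[V] x)).map (θ x) = θ c ≫ yonedaFamily c H' x := by
  rw [comp_yonedaFamily, ← hθ c x, yonedaFamily, ← MonoidalClosed.curry_natural_right,
    Category.assoc]

namespace IsNatObject

variable {F G : EnrichedFunctor V C V} {E E' : V}
  {π : ∀ x, E ⟶ (ihom (F.obj x)).obj (G.obj x)} {π' : ∀ x, E' ⟶ (ihom (F.obj x)).obj (G.obj x)}

theorem hom_ext (h : IsNatObject F G E π) {A : V} {f g : A ⟶ E} (w : ∀ x, f ≫ π x = g ≫ π x) :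
    f = g :=
  (h.universal A _ (h.natural.precomp_hom g)).unique w fun _ ↦ rfl

theorem exists_iso (h : IsNatObject F G E π) (h' : IsNatObject F G E' π') :
    ∃ e : E ≅ E', ∀ x, e.hom ≫ π' x = π x := by
  obtain ⟨f, hf, -⟩ := h'.universal E π h.natural
  obtain ⟨g, hg, -⟩ := h.universal E' π' h'.natural
  exact ⟨⟨f, g, h.hom_ext fun x ↦ by simp [hf, hg], h'.hom_ext fun x ↦ by simp [hf, hg]⟩, hf⟩

theorem of_iso (h : IsNatObject F G E π) (e : E' ≅ E) :
    IsNatObject F G E' (fun x ↦ e.hom ≫ π x) := by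
  refine ⟨h.natural.precomp_hom e.hom, fun A a ha ↦ ?_⟩
  obtain ⟨f, hf, hu⟩ := h.universal A a ha
  refine ⟨f ≫ e.inv, fun x ↦ by simp [hf], fun g hg ↦ ?_⟩
  rw [Iso.eq_comp_inv]
  exact hu _ fun x ↦ by simpa using hg x

/-- The `V`-Yoneda lemma: `H c` is the object of `V`-natural transformations from `C(c, -)` to
`H`. -/
theorem yoneda (c : C) (H : EnrichedFunctor V C V) :
    IsNatObject (representable c) H (H.obj c) (yonedaFamily c H) := by
  have htf : ∀ x, tform (representable c) H (yonedaFamily c H) x = act H c x := fun x ↦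
    (congrArg ((β_ (H.obj c) (c ⟶[V] x)).hom ≫ ·) (MonoidalClosed.uncurry_curry _)).trans
      (SymmetricCategory.symmetry_assoc _ _ _)
  refine ⟨fun x y ↦ (graded_iff (representable c) H (yonedaFamily c H) x y).2 ?_, fun A a ha ↦ ?_⟩
  · rw [htf, htf, act_representable]
    exact (act_comp H c x y).symm
  · obtain ⟨t, ht⟩ : ∃ t : ∀ x, A ⊗ (c ⟶[V] x) ⟶ H.obj x, t = tform (representable c) H a :=
      ⟨_, rfl⟩
    have hnat : ∀ x y, (α_ A (c ⟶[V] x) (x ⟶[V] y)).inv ≫ t x ▷ _ ≫ act H x y =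
        A ◁ eComp V c x y ≫ t y := fun x y ↦ by
      have h := (graded_iff (representable c) H a x y).1 (ha x y)
      rw [act_representable, ← ht] at h
      exact h
    have hta : ∀ x, a x = MonoidalClosed.curry ((β_ _ _).hom ≫ t x) := fun x ↦ by
      subst ht
      refine (MonoidalClosed.curry_uncurry _).symm.trans (congrArg MonoidalClosed.curry ?_)
      exact (SymmetricCategory.symmetry_assoc _ _ _).symm
    have hfac : ∀ (f : A ⟶ H.obj c) (x : C), f ≫ yonedaFamily c H x = a x ↔
        f ▷ (c ⟶[V] x) ≫ act H c x = t x := fun f x ↦ by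
      rw [hta, comp_yonedaFamily]
      refine MonoidalClosed.curry_injective.eq_iff.trans ?_
      exact cancel_epi (β_ (c ⟶[V] x) A).hom
    refine ⟨(ρ_ A).inv ≫ A ◁ eId V c ≫ t c, fun x ↦ (hfac _ x).2 ?_, fun f hf ↦ ?_⟩
    · have h' := A ◁ (λ_ (c ⟶[V] x)).inv ≫= A ◁ eId V c ▷ (c ⟶[V] x) ≫= hnat c x
      have hid := congrArg (A ◁ ·) (e_id_comp V c x)
      simp only [MonoidalCategory.whiskerLeft_comp, MonoidalCategory.whiskerLeft_id] at hid
      rw [reassoc_of% hid] at h'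
      rw [← h']
      simp
    · rw [← (hfac f c).1 (hf c)]
      exact (unit_act H f).symm

end IsNatObject

/-- If `L` is the left Kan extension of `G` along `J`, then `V`-natural transformations `L ⟶ H`
correspond to `V`-natural transformations `G ⟶ H J`. -/
theorem IsLeftKan.isNatObject {J : EnrichedFunctor V C D} {G : EnrichedFunctor V C V}
    {L H : EnrichedFunctor V D V} {η : ∀ c, G.obj c ⟶ L.obj (J.obj c)} (h : IsLeftKan J G L η)
    {E : V} {π : ∀ d, E ⟶ (ihom (L.obj d)).obj (H.obj d)} (hE : IsNatObject L H E π) :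
    IsNatObject G (J.comp V H) E
      (fun c ↦ π (J.obj c) ≫ (MonoidalClosed.pre (η c)).app (H.obj (J.obj c))) := by
  refine ⟨(hE.natural.precomp J).precomp_nat h.natural, fun A a ha ↦ ?_⟩
  obtain ⟨b, hb, hba⟩ := h.exists_natFamily H ha
  obtain ⟨f, hf, hu⟩ := hE.universal A b hb
  refine ⟨f, fun c ↦ ?_, fun g hg ↦ hu g (congrFun
    (h.natFamily_ext (hE.natural.precomp_hom g) hb fun c ↦ ?_))⟩
  · rw [← hba c, ← hf (J.obj c)]
    exact (Category.assoc _ _ _).symm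
  · rw [hba c]
    exact (Category.assoc _ _ _).trans (hg c)

/-- A `V`-natural transformation `θ` is invertible at `c` as soon as postcomposition with `θ`
identifies the objects of `V`-natural transformations out of `C(c, -)`. -/
theorem isIso_of_isNatObject {c : C} {H H' : EnrichedFunctor V C V} {θ : ∀ x, H.obj x ⟶ H'.obj x}
    (hθ : IsNatural H H' θ) {E : V}
    {π : ∀ x, E ⟶ (ihom ((representable (V := V) c).obj x)).obj (H.obj x)}
    (h : IsNatObject (representable c) H E π)
    (h' : IsNatObject (representable c) H' E (fun x ↦ π x ≫ (ihom _).map (θ x))) :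
    IsIso (θ c) := by
  obtain ⟨e, he⟩ := h.exists_iso (IsNatObject.yoneda c H)
  obtain ⟨e', he'⟩ := h'.exists_iso (IsNatObject.yoneda c H')
  have key : e.hom ≫ θ c = e'.hom := (IsNatObject.yoneda c H').hom_ext fun x ↦ by
    have h1 : (e.hom ≫ θ c) ≫ yonedaFamily c H' x =
        (e.hom ≫ yonedaFamily c H x) ≫ (ihom (c ⟶[V] x)).map (θ x) := by
      rw [Category.assoc, Category.assoc, yonedaFamily_map hθ]
    exact h1.trans ((congrArg (· ≫ (ihom (c ⟶[V] x)).map (θ x)) (he x)).trans (he' x).symm)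
  rw [← Iso.eq_inv_comp] at key
  rw [key]
  infer_instance

end NatObject

/-! ### Left Kan extension and restriction of small presheaves -/

namespace SmallPresheaf

variable {V : Type u} [Category.{w} V] [MonoidalCategory V] [SymmetricCategory V]
  [MonoidalClosed V] [IsLocallyPresentable.{w} V]
  {K : Type u₁} [EnrichedCategory V K] {L : Type u₂} [EnrichedCategory V L]
  (F : EnrichedFunctor V K L)

/-- `PL(PF(P), Q)` is the object of `V`-natural transformations from `P` to the restriction of `Q`
along `F`, whether or not that restriction is small. -/
theorem isNatObject_lan (P : SmallPresheaf V K) (Q : SmallPresheaf V L) :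
    IsNatObject P.presheaf ((opFunctor F).comp V Q.presheaf) (lanObj F P ⟶[V] Q)
      (fun k ↦ eval (lanObj F P) Q (op (F.obj k.unop)) ≫
        (MonoidalClosed.pre (lanUnit F P k)).app (Q.presheaf.obj (op (F.obj k.unop)))) :=
  (isLeftKan_lanObj F P).isNatObject (isNatObject (lanObj F P) Q)

/-- Precomposition with `PF(P) ⟶ PF(Q)` corresponds to precomposition with `P ⟶ Q`. -/
theorem lanMap_eComp_eval (P Q : SmallPresheaf V K) (G : SmallPresheaf V L) {A : V}
    (f : A ⟶ (lanObj F Q ⟶[V] G)) (k : Kᵒᵖ) :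
    (lanMap F P Q ⊗ₘ f) ≫ eComp V (lanObj F P) (lanObj F Q) G ≫
        eval (lanObj F P) G (op (F.obj k.unop)) ≫ (MonoidalClosed.pre (lanUnit F P k)).app _ =
      (eval P Q k ⊗ₘ (f ≫ eval (lanObj F Q) G (op (F.obj k.unop)) ≫
        (MonoidalClosed.pre (lanUnit F Q k)).app _)) ≫ MonoidalClosed.comp _ _ _ := by
  have h1 := tensor_comp_pre (lanUnit F P k)
    (lanMap F P Q ≫ eval (lanObj F P) (lanObj F Q) (op (F.obj k.unop)))
    (f ≫ eval (lanObj F Q) G (op (F.obj k.unop)))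
  have h2 := tensor_map_pre (lanUnit F Q k) (eval P Q k)
    (f ≫ eval (lanObj F Q) G (op (F.obj k.unop)))
  rw [Category.assoc (lanMap F P Q), lanMap_eval, h2, Category.assoc f, Category.assoc] at h1
  rw [eComp_eval_assoc, tensorHom_comp_tensorHom_assoc]
  exact h1

section Restriction

variable (P : SmallPresheaf V K) (G : SmallPresheaf V L)
  (hG : IsSmall ((opFunctor F).comp V G.presheaf))

/-- The projections of the end `∫_k [P k, G (F k)]`. -/
noncomputable def evalRestrict (k : Kᵒᵖ) : (P ⟶[V] restrict F G hG) ⟶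
    (ihom (P.presheaf.obj k)).obj (G.presheaf.obj (op (F.obj k.unop))) :=
  eval P (restrict F G hG) k

theorem hom_ext_restrict {A : V} {f g : A ⟶ (P ⟶[V] restrict F G hG)}
    (w : ∀ k, f ≫ evalRestrict F P G hG k = g ≫ evalRestrict F P G hG k) : f = g :=
  hom_ext w

theorem eComp_evalRestrict (P' : SmallPresheaf V K) (k : Kᵒᵖ) :
    eComp V P P' (restrict F G hG) ≫ evalRestrict F P G hG k =
      (eval P P' k ⊗ₘ evalRestrict F P' G hG k) ≫ MonoidalClosed.comp _ _ _ :=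
  eComp_eval P P' (restrict F G hG) k

/-- Postcomposition with the restriction of `G ⟶ G'` is computed by evaluating `G ⟶ G'` at `F k`. -/
theorem restrictMap_eComp_evalRestrict (G' : SmallPresheaf V L)
    (hG' : IsSmall ((opFunctor F).comp V G'.presheaf)) {A : V} (f : A ⟶ (P ⟶[V] restrict F G hG))
    (k : Kᵒᵖ) :
    (f ⊗ₘ restrictMap F G G' hG hG') ≫ eComp V P (restrict F G hG) (restrict F G' hG') ≫
        evalRestrict F P G' hG' k =
      ((f ≫ evalRestrict F P G hG k) ⊗ₘ eval G G' (op (F.obj k.unop))) ≫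
        MonoidalClosed.comp _ _ _ := by
  refine (_ ≫= eComp_eval P (restrict F G hG) (restrict F G' hG') k).trans ?_
  rw [tensorHom_comp_tensorHom_assoc, restrictMap_eval]
  rfl

theorem exists_lanHomIso :
    ∃ e : (lanObj F P ⟶[V] G) ≅ (P ⟶[V] restrict F G hG), ∀ k,
      e.hom ≫ evalRestrict F P G hG k = eval (lanObj F P) G (op (F.obj k.unop)) ≫
        (MonoidalClosed.pre (lanUnit F P k)).app (G.presheaf.obj (op (F.obj k.unop))) :=
  (isNatObject_lan F P G).exists_iso (isNatObject P (restrict F G hG))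

end Restriction

/-- When restriction along `F` preserves smallness, it is right adjoint to left Kan extension. -/
theorem nonempty_lan_adjunction
    (h : ∀ G : SmallPresheaf V L, IsSmall ((opFunctor F).comp V G.presheaf)) :
    Nonempty (VAdjunction (lan F) (restriction F h)) := by
  choose e he using fun P G ↦ exists_lanHomIso F P G (h G)
  have hl : ∀ P P' G, lanMap F P P' ▷ (lanObj F P' ⟶[V] G) ≫
      eComp V (lanObj F P) (lanObj F P') G ≫ (e P G).hom =
        (P ⟶[V] P') ◁ (e P' G).hom ≫ eComp V P P' (restrict F G (h G)) := fun P P' G ↦ by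
    refine hom_ext_restrict F P G (h G) fun k ↦ ?_
    have h1 := lanMap_eComp_eval F P P' G (𝟙 _) k
    rw [tensorHom_id, Category.id_comp] at h1
    rw [Category.assoc, Category.assoc, Category.assoc, he, h1, eComp_evalRestrict,
      ← id_tensorHom, tensorHom_comp_tensorHom_assoc, Category.id_comp, he]
  have hr : ∀ P G G', eComp V (lanObj F P) G G' ≫ (e P G').hom =
      ((e P G).hom ⊗ₘ restrictMap F G G' (h G) (h G')) ≫
        eComp V P (restrict F G (h G)) (restrict F G' (h G')) := fun P G G' ↦ by
    refine hom_ext_restrict F P G' (h G') fun k ↦ ?_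
    have h1 := tensor_comp_pre (lanUnit F P k) (eval (lanObj F P) G (op (F.obj k.unop)))
      (eval G G' (op (F.obj k.unop)))
    rw [Category.assoc] at h1
    rw [Category.assoc, Category.assoc, he, eComp_eval_assoc, restrictMap_eComp_evalRestrict, he,
      h1]
  exact ⟨⟨e, hl, hr⟩⟩

/-- If `PF` has a right adjoint `R`, then the counit of the adjunction at `G` transposes to a
`V`-natural transformation from `R G` to the restriction of `G` along `F`. It is invertible, because
composing with it is the bijection `PK(K(-, k), R G) ≅ PL(PF(K(-, k)), G)`. -/
theorem isSmall_comp_of_adjunction {R : EnrichedFunctor V (SmallPresheaf V L) (SmallPresheaf V K)}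
    (adj : VAdjunction (lan F) R) (G : SmallPresheaf V L) :
    IsSmall ((opFunctor F).comp V G.presheaf) := by
  -- The transpose of the counit, first as a family of elements and then as a family of maps.
  obtain ⟨a, ha⟩ : ∃ a : ∀ k : Kᵒᵖ, 𝟙_ V ⟶ (ihom ((R.obj G).presheaf.obj k)).obj
      (((opFunctor F).comp V G.presheaf).obj k), a = fun k ↦ adj.counit G ≫
      eval (lanObj F (R.obj G)) G (op (F.obj k.unop)) ≫
        (MonoidalClosed.pre (lanUnit F (R.obj G) k)).app _ := ⟨_, rfl⟩
  have ha_nat : IsNatFamily (R.obj G).presheaf ((opFunctor F).comp V G.presheaf) a := by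
    rw [ha]
    exact (isNatObject_lan F (R.obj G) G).natural.precomp_hom (adj.counit G)
  obtain ⟨θ, hθ⟩ : ∃ θ : ∀ k, (R.obj G).presheaf.obj k ⟶ ((opFunctor F).comp V G.presheaf).obj k,
      θ = fun k ↦ (ρ_ _).inv ≫ MonoidalClosed.uncurry (a k) := ⟨_, rfl⟩
  have hθ_nat : IsNatural _ _ θ := by
    rw [hθ]
    exact ha_nat.isNatural
  -- By naturality of the adjunction in `P`, its isomorphism is composition with `θ`.
  have key : ∀ (P : SmallPresheaf V K) (k : Kᵒᵖ), (adj.homIso P G).inv ≫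
      eval (lanObj F P) G (op (F.obj k.unop)) ≫ (MonoidalClosed.pre (lanUnit F P k)).app _ =
        eval P (R.obj G) k ≫ (ihom (P.presheaf.obj k)).map (θ k) := fun P k ↦ by
    have h1 := lanMap_eComp_eval F P (R.obj G) G (adj.counit G) k
    have h2 := comp_element (eval P (R.obj G) k) (a k)
    rw [adj.homIso_inv, Category.assoc, Category.assoc, hθ, ← h2, ha]
    exact _ ≫= h1
  have hiso : ∀ k, IsIso (θ k) := fun k ↦ by
    let P : SmallPresheaf V K := ⟨representable k, isSmall_representable k⟩
    refine isIso_of_isNatObject hθ_nat (isNatObject P (R.obj G)) ?_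
    rw [← funext (key P)]
    exact (isNatObject_lan F P G).of_iso (adj.homIso P G).symm
  exact (R.obj G).isSmall.of_iso (fun k ↦ asIso (θ k)) hθ_nat

end SmallPresheaf
end EnrichedPresheaf

theorem mainTheorem5
    {V : Type u} [Category.{w} V] [MonoidalCategory V] [SymmetricCategory V] [MonoidalClosed V]
    [IsLocallyPresentable.{w} V]
    {K : Type u₁} [EnrichedCategory V K] {L : Type u₂} [EnrichedCategory V L]
    (F : EnrichedFunctor V K L) :
    ((∃ R : EnrichedFunctor V (SmallPresheaf V L) (SmallPresheaf V K),
        Nonempty (VAdjunction (SmallPresheaf.lan F) R)) ↔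
      ∀ l : L, IsSmall ((opFunctor F).comp V (representable (op l)))) ∧
    ((∀ l : L, IsSmall ((opFunctor F).comp V (representable (op l)))) →
      ∃ h : ∀ G : SmallPresheaf V L, IsSmall ((opFunctor F).comp V G.presheaf),
        Nonempty (VAdjunction (SmallPresheaf.lan F) (SmallPresheaf.restriction F h))) ∧
    (∀ R : EnrichedFunctor V (SmallPresheaf V L) (SmallPresheaf V K),
      Nonempty (VAdjunction (SmallPresheaf.lan F) R) →
        ∃ h : ∀ G : SmallPresheaf V L, IsSmall ((opFunctor F).comp V G.presheaf),
          Nonempty (VNatIso R (SmallPresheaf.restriction F h))) := by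
  have hsmall : (∀ l : L, IsSmall ((opFunctor F).comp V (representable (op l)))) →
      ∀ G : SmallPresheaf V L, IsSmall ((opFunctor F).comp V G.presheaf) :=
    fun h G ↦ IsSmall.precomp (fun l ↦ h l.unop) G.isSmall
  refine ⟨⟨fun ⟨R, ⟨adj⟩⟩ l ↦ ?_, fun h ↦ ?_⟩, fun h ↦ ?_, fun R ⟨adj⟩ ↦ ?_⟩
  · exact SmallPresheaf.isSmall_comp_of_adjunction F adj
      ⟨representable (op l), isSmall_representable (op l)⟩
  · exact ⟨_, SmallPresheaf.nonempty_lan_adjunction F (hsmall h)⟩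
  · exact ⟨hsmall h, SmallPresheaf.nonempty_lan_adjunction F (hsmall h)⟩
  · have h := SmallPresheaf.isSmall_comp_of_adjunction F adj
    obtain ⟨adj'⟩ := SmallPresheaf.nonempty_lan_adjunction F h
    exact ⟨h, ⟨adj.rightAdjointUniq adj'⟩⟩
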